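/- Define the integers $v_0(n)$, $n\ge 0$, by the formal power series identity $$\sum_{n=0}^\infty v_0(n)q^n=\sum_{n=0}^\infty \frac{q^{n^2}(-q;q^2)_n}{(q;q^2)_n},\qquad (a;q)_n=\prod_{i=1}^n(1-aq^{i-1}).$$ Let $p\ge 3$ and $p_1\ge 5$ be primes, not necessarily distinct. Then for all integers $n\ge 0$ and $\alpha\ge 0$: 1. if $n\ne k(3k+1)/2$ for every $k\in\mathbb Z$, then $v_0\big(p^{2\alpha}(96n+4)\big)\equiv 0\pmod{27}$; 2. for every $i\in\{1,2,\dots,p_1-1\}$, $v_0\big(p^{2\alpha}p_1(96p_1n+96i+4p_1)\big)\equiv 0\pmod{27}$; 3. for every integer $j\ge 0$ such that $24j+1$ is a quadratic nonresidue modulo $p_1$, $v_0\big(p^{2\alpha}(96p_1n+96j+4)\big)\equiv 0\pmod{27}$. -/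

import Mathlib

open scoped PowerSeries

/-- The finite `q`-Pochhammer symbol `(a; q)_n = ∏_{i=1}^n (1 - a q^{i-1})`. -/
def qPoch {R : Type*} [CommRing R] (a q : R) (n : ℕ) : R :=
  ∏ i ∈ Finset.range n, (1 - a * q ^ i)

/-- The formal power series `q^{k²} (-q; q²)_k / (q; q²)_k`, where `q` is the variable `X`. The
denominator has constant term `1`, so it is invertible in `ℤ⟦X⟧` (see `v0Term_mul`). -/
noncomputable def v0Term (k : ℕ) : ℤ⟦X⟧ :=
  PowerSeries.X ^ (k ^ 2) * qPoch (-PowerSeries.X) (PowerSeries.X ^ 2) k *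
    PowerSeries.invOfUnit (qPoch PowerSeries.X (PowerSeries.X ^ 2) k) 1

/-- `v₀(n)`, the coefficient of `q^n` in `∑_{k ≥ 0} q^{k²} (-q; q²)_k / (q; q²)_k`. The `k`-th term
is divisible by `q^{k²}`, so only the terms with `k ≤ n` contribute (see `hasSum_v0Term`). -/
noncomputable def v0 (n : ℕ) : ℤ :=
  ∑ k ∈ Finset.range (n + 1), PowerSeries.coeff n (v0Term k)

theorem v0Term_mul (k : ℕ) :
    v0Term k * qPoch PowerSeries.X (PowerSeries.X ^ 2) k =
      PowerSeries.X ^ (k ^ 2) * qPoch (-PowerSeries.X) (PowerSeries.X ^ 2) k := by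
  have h : PowerSeries.constantCoeff (qPoch (PowerSeries.X : ℤ⟦X⟧) (PowerSeries.X ^ 2) k) =
      ((1 : ℤˣ) : ℤ) := by
    simp [qPoch, map_prod]
  rw [v0Term, mul_assoc, PowerSeries.invOfUnit_mul _ _ h, mul_one]

open scoped PowerSeries.WithPiTopology in
/-- `∑_{n ≥ 0} v₀(n) q^n = ∑_{k ≥ 0} q^{k²} (-q; q²)_k / (q; q²)_k` as formal power series. -/
theorem hasSum_v0Term : HasSum v0Term (PowerSeries.mk v0) := by
  rw [PowerSeries.WithPiTopology.hasSum_iff_hasSum_coeff]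
  intro n
  rw [PowerSeries.coeff_mk]
  refine hasSum_sum_of_ne_finset_zero fun k hk => ?_
  have hk' : n < k := by simpa using hk
  have : n < k ^ 2 := lt_of_lt_of_le hk' (Nat.le_self_pow two_ne_zero k)
  rw [v0Term, mul_assoc, PowerSeries.coeff_X_pow_mul', if_neg (by omega)]

/-! Write φ(q) = ∑ q^{n²} over ℤ, ψ(q) = ∑ q^{n(n+1)/2} over n ≥ 0, A = f(q, q²) and Ω = f(-q, -q⁵),
with f Ramanujan's theta function.

The defining series is embedded in a family S(t), equal to it at t = -q, with a first-order
q²-difference equation. In S(t) + S(-t) - 1 the inhomogeneous term cancels; iterating t ↦ q²t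
towards 0 gives 2∑v₀(2n)qⁿ - 1 = φ(q)²/φ(-q²) (`two_mul_mk_v0_two_mul`). Successive 2-dissections
then give ∑v₀(32n+4)qⁿ = 3ψ(q) + 512qψ(q)⁹/φ(-q)⁸ (`mk_v0_thirtytwo_mul`).

Since ψ(q)/φ(-q) ≡ A(q³)/φ(-q⁹) mod 3, ninth powers agree mod 27, so the second summand is ≡ 512q
A(q³)⁹φ(-q)/φ(-q⁹)⁹. As φ(-q) has no exponents ≡ 2 mod 3, the exponents ≡ 0 mod 3 disappear: v₀(4m)
≡ 0 mod 27 when m ≡ 1 mod 24 is not a square (`dvd_v0_of_mod_three`). A further 3-dissection leaves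
512ψ(q) + 18432qψ(q⁹), whence v₀(36m) ≡ 0 for nonsquare m ≡ 1 mod 8 (`dvd_v0_nine_mul`); this is
needed for p = 3. For p ≥ 5, p² ≡ 1 mod 24, so a factor p^{2α} preserves the first criterion. In
each of the three families the argument of v₀ is p^{2α}·4m with m ≡ 1 mod 24 not a square. -/

open Filter Topology
open scoped PowerSeries.WithPiTopology

/-! ### X-adic limits and infinite products. -/

/-- A sequence of power series whose `n`-th term agrees with `l` modulo `X ^ n` tends to `l`. -/
theorem PowerSeries.tendsto_of_X_pow_dvd {s : ℕ → ℤ⟦X⟧} {l : ℤ⟦X⟧}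
    (h : ∀ n, PowerSeries.X ^ n ∣ s n - l) : Tendsto s atTop (𝓝 l) := by
  rw [PowerSeries.WithPiTopology.tendsto_iff_coeff_tendsto]
  intro d
  refine tendsto_atTop_of_eventually_const (i₀ := d + 1) fun i hi => ?_
  have := PowerSeries.X_pow_dvd_iff.mp (h i) d (by omega)
  rw [map_sub] at this
  linarith

theorem PowerSeries.exists_X_pow_dvd_of_succ {s : ℕ → ℤ⟦X⟧}
    (h : ∀ n, PowerSeries.X ^ n ∣ s (n + 1) - s n) :
    ∃ l : ℤ⟦X⟧, ∀ n, PowerSeries.X ^ n ∣ s n - l := by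
  have key : ∀ n k, PowerSeries.X ^ n ∣ s (n + k) - s n := by
    intro n k
    induction k with
    | zero => simp
    | succ k ih =>
      have := (pow_dvd_pow (PowerSeries.X : ℤ⟦X⟧) (Nat.le_add_right n k)).trans (h (n + k))
      have := dvd_add this ih
      simpa [add_assoc] using this
  -- The hypothesis at index n fixes only coefficients below n, so the coefficient of X^n is final
  -- from `s (n + 1)` on.
  refine ⟨PowerSeries.mk fun n => PowerSeries.coeff n (s (n + 1)), fun n => ?_⟩
  rw [PowerSeries.X_pow_dvd_iff]
  intro m hm
  obtain ⟨k, rfl⟩ : ∃ k, n = m + 1 + k := ⟨n - (m + 1), by omega⟩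
  have := PowerSeries.X_pow_dvd_iff.mp (key (m + 1) k) m (by omega)
  simpa using this

theorem PowerSeries.tendsto_expand {s : ℕ → ℤ⟦X⟧} {l : ℤ⟦X⟧} (h : Tendsto s atTop (𝓝 l))
    (d : ℕ) (hd : d ≠ 0) :
    Tendsto (fun n => PowerSeries.expand d hd (s n)) atTop (𝓝 (PowerSeries.expand d hd l)) := by
  rw [PowerSeries.WithPiTopology.tendsto_iff_coeff_tendsto] at h ⊢
  intro m
  simp only [PowerSeries.coeff_expand]
  split_ifs
  · exact h _
  · exact tendsto_const_nhds

/-- The infinite product `∏_{i ≥ 0} (1 + u q^i)`. -/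
noncomputable def infPoch (u q : ℤ⟦X⟧) : ℤ⟦X⟧ := ∏' i : ℕ, (1 + u * q ^ i)

theorem X_pow_dvd_pow_of_constantCoeff {q : ℤ⟦X⟧} (hq : PowerSeries.constantCoeff q = 0) (n : ℕ) :
    PowerSeries.X ^ n ∣ q ^ n :=
  pow_dvd_pow_of_dvd (PowerSeries.X_dvd_iff.mpr hq) n

theorem tendsto_infPoch {u q : ℤ⟦X⟧} (hu : PowerSeries.constantCoeff u = 0)
    (hq : PowerSeries.constantCoeff q = 0) :
    Tendsto (fun n => ∏ i ∈ Finset.range n, (1 + u * q ^ i)) atTop (𝓝 (infPoch u q)) := by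
  refine (PowerSeries.WithPiTopology.multipliable_one_add_of_tendsto_order_atTop_nhds_top ℤ
    ?_).hasProd.tendsto_prod_nat
  refine ENat.tendsto_nhds_top_iff_natCast_lt.mpr fun n => eventually_atTop.mpr ⟨n, fun m hm => ?_⟩
  have h : PowerSeries.X ^ (m + 1) ∣ u * q ^ m := by
    rw [pow_succ']
    exact mul_dvd_mul (PowerSeries.X_dvd_iff.mpr hu) (X_pow_dvd_pow_of_constantCoeff hq m)
  refine lt_of_lt_of_le ?_ (PowerSeries.le_order _ (m + 1) fun i hi =>
    PowerSeries.X_pow_dvd_iff.mp h i (by exact_mod_cast hi))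
  exact_mod_cast Nat.lt_succ_of_le hm

theorem infPoch_split_two {u q : ℤ⟦X⟧} (hu : PowerSeries.constantCoeff u = 0)
    (hq : PowerSeries.constantCoeff q = 0) :
    infPoch u q = infPoch u (q ^ 2) * infPoch (u * q) (q ^ 2) := by
  have h1 := (tendsto_infPoch hu hq).comp (tendsto_id.const_mul_atTop' (show 0 < 2 by norm_num))
  refine tendsto_nhds_unique h1 (((tendsto_infPoch hu (q := q ^ 2) (by simp [hq])).mul
    (tendsto_infPoch (u := u * q) (q := q ^ 2) (by simp [hu]) (by simp [hq]))).congr fun n => ?_)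
  simp only [Function.comp, id]
  induction n with
  | zero => simp
  | succ n ih =>
    rw [mul_add, mul_one, Finset.prod_range_succ, Finset.prod_range_succ, Finset.prod_range_succ,
      Finset.prod_range_succ, ← ih]
    ring

theorem infPoch_split_three {u q : ℤ⟦X⟧} (hu : PowerSeries.constantCoeff u = 0)
    (hq : PowerSeries.constantCoeff q = 0) :
    infPoch u q = infPoch u (q ^ 3) * infPoch (u * q) (q ^ 3) * infPoch (u * q ^ 2) (q ^ 3) := by
  have h1 := (tendsto_infPoch hu hq).comp (tendsto_id.const_mul_atTop' (show 0 < 3 by norm_num))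
  refine tendsto_nhds_unique h1 ((((tendsto_infPoch hu (q := q ^ 3) (by simp [hq])).mul
    (tendsto_infPoch (u := u * q) (q := q ^ 3) (by simp [hu]) (by simp [hq]))).mul
    (tendsto_infPoch (u := u * q ^ 2) (q := q ^ 3) (by simp [hu]) (by simp [hq]))).congr
    fun n => ?_)
  simp only [Function.comp, id]
  induction n with
  | zero => simp
  | succ n ih =>
    rw [mul_add, mul_one, Finset.prod_range_succ, Finset.prod_range_succ, Finset.prod_range_succ,
      Finset.prod_range_succ, Finset.prod_range_succ, Finset.prod_range_succ, ← ih]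
    ring

theorem infPoch_mul_neg {u q : ℤ⟦X⟧} (hu : PowerSeries.constantCoeff u = 0)
    (hq : PowerSeries.constantCoeff q = 0) :
    infPoch u q * infPoch (-u) q = infPoch (-u ^ 2) (q ^ 2) := by
  refine tendsto_nhds_unique ((tendsto_infPoch hu hq).mul (tendsto_infPoch (u := -u)
    (by simp [hu]) hq)) ((tendsto_infPoch (u := -u ^ 2) (q := q ^ 2) (by simp [hu])
    (by simp [hq])).congr fun n => ?_)
  rw [← Finset.prod_mul_distrib]
  exact Finset.prod_congr rfl fun i _ => by ring

theorem expand_infPoch {u q : ℤ⟦X⟧} (hu : PowerSeries.constantCoeff u = 0)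
    (hq : PowerSeries.constantCoeff q = 0) (d : ℕ) (hd : d ≠ 0) :
    PowerSeries.expand d hd (infPoch u q) =
      infPoch (PowerSeries.expand d hd u) (PowerSeries.expand d hd q) := by
  refine tendsto_nhds_unique (PowerSeries.tendsto_expand (tendsto_infPoch hu hq) d hd)
    ((tendsto_infPoch (by simpa using hu) (by simpa using hq)).congr fun n => ?_)
  simp [map_prod]

theorem constantCoeff_infPoch {u q : ℤ⟦X⟧} (hu : PowerSeries.constantCoeff u = 0)
    (hq : PowerSeries.constantCoeff q = 0) : PowerSeries.constantCoeff (infPoch u q) = 1 := by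
  have := ((PowerSeries.WithPiTopology.continuous_constantCoeff (R := ℤ)).tendsto _).comp
    (tendsto_infPoch hu hq)
  refine tendsto_nhds_unique this ?_
  simp [Function.comp_def, map_prod, hu]

/-- Euler's product `∏_{i ≥ 1} (1 - q^{d i})`. -/
noncomputable def eulerProd (d : ℕ) : ℤ⟦X⟧ :=
  infPoch (-PowerSeries.X ^ d) (PowerSeries.X ^ d)

theorem expand_eulerProd (d k : ℕ) (hd : d ≠ 0) (hk : k ≠ 0) :
    PowerSeries.expand d hd (eulerProd k) = eulerProd (d * k) := by
  rw [eulerProd, expand_infPoch (by simp [hk]) (by simp [hk])]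
  simp [eulerProd, pow_mul]

theorem eulerProd_ne_zero (d : ℕ) (hd : d ≠ 0) : eulerProd d ≠ 0 := by
  intro h
  have := constantCoeff_infPoch (u := -PowerSeries.X ^ d) (q := PowerSeries.X ^ d) (by simp [hd])
    (by simp [hd])
  rw [← eulerProd, h] at this
  simp at this

theorem infPoch_odd_mul_eulerProd (d : ℕ) (hd : d ≠ 0) :
    infPoch (-PowerSeries.X ^ d) (PowerSeries.X ^ (2 * d)) * eulerProd (2 * d) = eulerProd d := by
  rw [eulerProd, eulerProd, infPoch_split_two (q := PowerSeries.X ^ d) (by simp [hd])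
    (by simp [hd]), neg_mul, ← pow_add, ← two_mul, ← pow_mul, mul_comm d 2]

theorem infPoch_pos_mul_eulerProd (d : ℕ) (hd : d ≠ 0) :
    infPoch (PowerSeries.X ^ d) (PowerSeries.X ^ d) * eulerProd d = eulerProd (2 * d) := by
  rw [eulerProd, eulerProd, infPoch_mul_neg (by simp [hd]) (by simp [hd]), ← pow_mul, mul_comm d 2]

/-! ### Gaussian binomials and the Jacobi triple product. -/

/-- The Gaussian binomial coefficient. -/
def qBinom {R : Type*} [CommRing R] (q : R) : ℕ → ℕ → R
  | _, 0 => 1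
  | 0, _ + 1 => 0
  | m + 1, k + 1 => qBinom q m (k + 1) + q ^ (m - k) * qBinom q m k

section qBinom

variable {R : Type*} [CommRing R] (q : R)

theorem qBinom_zero_right (m : ℕ) : qBinom q m 0 = 1 := by cases m <;> rfl

theorem qBinom_succ_succ (m k : ℕ) :
    qBinom q (m + 1) (k + 1) = qBinom q m (k + 1) + q ^ (m - k) * qBinom q m k := rfl

theorem qBinom_eq_zero_of_lt {m k : ℕ} (h : m < k) : qBinom q m k = 0 := by
  induction m generalizing k with
  | zero => obtain ⟨k, rfl⟩ := Nat.exists_eq_succ_of_ne_zero h.ne'; rfl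
  | succ m ih =>
    obtain ⟨k, rfl⟩ := Nat.exists_eq_succ_of_ne_zero (show k ≠ 0 by omega)
    rw [Nat.succ_eq_add_one, qBinom_succ_succ, ih (by omega), ih (by omega)]
    ring

theorem qBinom_self (m : ℕ) : qBinom q m m = 1 := by
  induction m with
  | zero => rfl
  | succ m ih => rw [qBinom_succ_succ, qBinom_eq_zero_of_lt q (Nat.lt_succ_self m), ih]; simp

theorem qPoch_succ (a : R) (n : ℕ) : qPoch a q (n + 1) = qPoch a q n * (1 - a * q ^ n) :=
  Finset.prod_range_succ _ _

/-- The factorial formula without division. The inductive step is 1 - q^{k+l+2} = (1 - q^{l+1}) +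
q^{l+1}(1 - q^{k+1}). -/
theorem qBinom_mul_qPoch (k l : ℕ) :
    qBinom q (k + l) k * (qPoch q q k * qPoch q q l) = qPoch q q (k + l) := by
  induction h : k + l generalizing k l with
  | zero =>
    obtain ⟨rfl, rfl⟩ : k = 0 ∧ l = 0 := by omega
    simp [qPoch, qBinom]
  | succ m ih =>
    rcases k with _ | k
    · obtain rfl : l = m + 1 := by omega
      simp [qPoch, qBinom_zero_right]
    rcases l with _ | l
    · obtain rfl : k = m := by omega
      simp [qPoch, qBinom_self]
    have h1 := ih (k + 1) l (by omega)
    have h2 := ih k (l + 1) (by omega)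
    have h3 : m - k = l + 1 := by omega
    obtain rfl : m = k + l + 1 := by omega
    rw [qBinom_succ_succ, h3, add_mul]
    rw [qPoch_succ q q l, qPoch_succ q q k] at *
    rw [qPoch_succ q q (k + l + 1), show qBinom q (k + l + 1) (k + 1) *
      (qPoch q q k * (1 - q * q ^ k) * (qPoch q q l * (1 - q * q ^ l))) =
      qPoch q q (k + l + 1) * (1 - q * q ^ l) by rw [← h1]; ring,
      show q ^ (l + 1) * qBinom q (k + l + 1) k *
      (qPoch q q k * (1 - q * q ^ k) * (qPoch q q l * (1 - q * q ^ l))) =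
      q ^ (l + 1) * (1 - q * q ^ k) * qPoch q q (k + l + 1) by rw [← h2]; ring]
    ring

end qBinom

theorem isUnit_qPoch {a q : ℤ⟦X⟧} (ha : PowerSeries.constantCoeff a = 0) (n : ℕ) :
    IsUnit (qPoch a q n) := by
  rw [PowerSeries.isUnit_iff_constantCoeff, qPoch, map_prod]
  simp [ha]

section theta

/-- The general term `u ^ (n (n + 1) / 2) * v ^ (n (n - 1) / 2)` of Ramanujan's theta function. -/
def thetaTerm {R : Type*} [CommRing R] (u v : R) (n : ℤ) : R :=
  u ^ (n * (n + 1) / 2).toNat * v ^ (n * (n - 1) / 2).toNat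

theorem toNat_triangle_succ (n : ℤ) :
    (((n + 1) * (n + 1 + 1) / 2).toNat : ℤ) = (n * (n + 1) / 2).toNat + (n + 1) := by
  have h1 : (n + 1) * (n + 1 + 1) = n * (n + 1) + (n + 1) * 2 := by ring
  have h2 : 0 ≤ n * (n + 1) := by
    rcases le_or_gt 0 n with h | h <;> nlinarith
  have h3 : 0 ≤ (n + 1) * (n + 1 + 1) := by
    rcases le_or_gt 0 (n + 1) with h | h <;> nlinarith
  rw [Int.toNat_of_nonneg (by positivity), Int.toNat_of_nonneg (by positivity), h1,
    Int.add_mul_ediv_right _ _ (by norm_num)]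

variable {R : Type*} [CommRing R] (u v : R)

theorem thetaTerm_zero : thetaTerm u v 0 = 1 := by simp [thetaTerm]

theorem thetaTerm_neg (n : ℤ) : thetaTerm u v (-n) = thetaTerm v u n := by
  rw [thetaTerm, thetaTerm, mul_comm, show -n * (-n - 1) = n * (n + 1) by ring,
    show -n * (-n + 1) = n * (n - 1) by ring]

theorem thetaTerm_step {n : ℤ} {a b : ℕ} (h : (b : ℤ) = a - n) :
    u * (u * v) ^ a * thetaTerm u v n = (u * v) ^ b * thetaTerm u v (n + 1) := by
  have h1 := toNat_triangle_succ n
  have h2 := toNat_triangle_succ (n - 1)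
  rw [sub_add_cancel] at h2
  have e1 : 1 + a + (n * (n + 1) / 2).toNat = b + ((n + 1) * (n + 1 + 1) / 2).toNat := by omega
  have e2 : a + (n * (n - 1) / 2).toNat = b + ((n + 1) * (n + 1 - 1) / 2).toNat := by
    rw [add_sub_cancel_right, mul_comm (n + 1) n]
    rw [mul_comm (n - 1) n] at h2
    omega
  calc _ = u ^ (1 + a + (n * (n + 1) / 2).toNat) * v ^ (a + (n * (n - 1) / 2).toNat) := by
        rw [thetaTerm]; ring
    _ = _ := by rw [e1, e2, thetaTerm]; ring

/-- By `thetaTerm_step`, the k-th summand times u(uv)^N is the second Pascal term of the summand k +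
1. -/
theorem finite_triple_step (N K : ℕ) :
    (∑ k ∈ Finset.range (N + K + 1), qBinom (u * v) (N + K) k * thetaTerm u v (k - K)) *
      (1 + u * (u * v) ^ N) =
    ∑ k ∈ Finset.range (N + K + 1 + 1),
      qBinom (u * v) (N + K + 1) k * thetaTerm u v (k - K) := by
  rw [Finset.sum_range_succ' _ (N + K + 1), mul_add, mul_one, Finset.sum_mul]
  have h1 : ∀ k ∈ Finset.range (N + K + 1),
      qBinom (u * v) (N + K) k * thetaTerm u v (k - K) * (u * (u * v) ^ N) =
      (u * v) ^ (N + K - k) * qBinom (u * v) (N + K) k * thetaTerm u v ((k + 1 : ℕ) - K) := by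
    intro k hk
    rw [Finset.mem_range] at hk
    have := thetaTerm_step u v (n := k - K) (a := N) (b := N + K - k) (by omega)
    rw [show ((k + 1 : ℕ) - K : ℤ) = k - K + 1 by push_cast; ring, mul_comm ((u * v) ^ _)
      (qBinom _ _ _), mul_assoc (qBinom _ _ _) ((u * v) ^ _), ← this]
    ring
  rw [Finset.sum_congr rfl h1]
  simp only [qBinom_succ_succ, add_mul, Finset.sum_add_distrib]
  rw [add_right_comm _ _ (qBinom (u * v) (N + K + 1) 0 * _)]
  congr 1
  rw [qBinom_zero_right, ← qBinom_zero_right (u * v) (N + K),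
    ← Finset.sum_range_succ' (fun k : ℕ => qBinom (u * v) (N + K) k * thetaTerm u v (k - K)),
    Finset.sum_range_succ _ (N + K + 1), qBinom_eq_zero_of_lt _ (Nat.lt_succ_self _)]
  simp

end theta

theorem qBinom_symm {q : ℤ⟦X⟧} (hq : PowerSeries.constantCoeff q = 0) (k l : ℕ) :
    qBinom q (k + l) k = qBinom q (k + l) l := by
  have h1 := qBinom_mul_qPoch q k l
  have h2 := qBinom_mul_qPoch q l k
  rw [add_comm l k, ← h1, mul_comm (qPoch q q l)] at h2
  exact (((isUnit_qPoch hq k).mul (isUnit_qPoch hq l)).mul_right_cancel h2).symm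

theorem finite_triple_left (u v : ℤ⟦X⟧) (N K : ℕ) :
    (∑ k ∈ Finset.range (K + 1), qBinom (u * v) K k * thetaTerm u v (k - K)) *
      ∏ i ∈ Finset.range N, (1 + u * (u * v) ^ i) =
    ∑ k ∈ Finset.range (N + K + 1), qBinom (u * v) (N + K) k * thetaTerm u v (k - K) := by
  induction N with
  | zero => simp
  | succ N ih =>
    rw [Finset.prod_range_succ, ← mul_assoc, ih, finite_triple_step, Nat.add_right_comm N 1 K]

/-- The finite form of the Jacobi triple product identity. -/
theorem finite_triple_product {u v : ℤ⟦X⟧} (hu : PowerSeries.constantCoeff u = 0) (N K : ℕ) :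
    (∏ i ∈ Finset.range N, (1 + u * (u * v) ^ i)) *
      ∏ i ∈ Finset.range K, (1 + v * (u * v) ^ i) =
    ∑ k ∈ Finset.range (N + K + 1), qBinom (u * v) (N + K) k * thetaTerm u v (k - K) := by
  rw [← finite_triple_left, mul_comm]
  congr 1
  -- The remaining sum is the v-product: exchange u and v, start from the empty product, and reflect
  -- k ↦ K - k.
  have h := finite_triple_left v u K 0
  rw [mul_comm v u] at h
  simp only [zero_add, Finset.sum_range_one, qBinom_zero_right, Nat.cast_zero, sub_zero, add_zero,
    thetaTerm_zero, one_mul] at h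
  rw [h, ← Finset.sum_range_reflect]
  refine Finset.sum_congr rfl fun k hk => ?_
  rw [Finset.mem_range] at hk
  obtain ⟨l, rfl⟩ : ∃ l, K = k + l := ⟨K - k, by omega⟩
  rw [show k + l + 1 - 1 - k = l by omega, ← qBinom_symm (by simp [hu]), ← thetaTerm_neg]
  congr 2
  push_cast
  ring

theorem X_pow_dvd_qPoch_sub {q : ℤ⟦X⟧} (hq : PowerSeries.constantCoeff q = 0) (j k : ℕ) :
    PowerSeries.X ^ j ∣ qPoch q q (j + k) - qPoch q q j := by
  induction k with
  | zero => simp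
  | succ k ih =>
    rw [← add_assoc, qPoch_succ, mul_sub, mul_one, sub_right_comm]
    refine dvd_sub ih (Dvd.dvd.mul_left ?_ _)
    rw [← pow_succ']
    exact (pow_dvd_pow _ (by omega)).trans (X_pow_dvd_pow_of_constantCoeff hq _)

theorem X_pow_dvd_thetaTerm {u v : ℤ⟦X⟧} (hu : PowerSeries.constantCoeff u = 0)
    (hv : PowerSeries.constantCoeff v = 0) {N : ℕ} {n : ℤ} (h : N ≤ n.natAbs) :
    PowerSeries.X ^ N ∣ thetaTerm u v n := by
  refine (pow_dvd_pow _ ?_).trans ((pow_add (PowerSeries.X : ℤ⟦X⟧) _ _).dvd.trans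
    (mul_dvd_mul (X_pow_dvd_pow_of_constantCoeff hu _) (X_pow_dvd_pow_of_constantCoeff hv _)))
  have h2 := toNat_triangle_succ (n - 1)
  rw [sub_add_cancel, mul_comm (n - 1) n] at h2
  omega

/-- All symbols (q; q)_m with m ≥ N agree modulo X^N, so (q)_M (q)_{k+l} / ((q)_k (q)_l) is
congruent to 1. -/
theorem X_pow_dvd_qPoch_mul_qBinom_sub_one {q : ℤ⟦X⟧} (hq : PowerSeries.constantCoeff q = 0)
    {N M k l : ℕ} (hM : N ≤ M) (hk : N ≤ k) (hl : N ≤ l) :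
    PowerSeries.X ^ N ∣ qPoch q q M * qBinom q (k + l) k - 1 := by
  have key : ∀ {m : ℕ}, N ≤ m → PowerSeries.X ^ N ∣ qPoch q q m - qPoch q q N := by
    intro m hm
    obtain ⟨j, rfl⟩ := Nat.exists_eq_add_of_le hm
    exact X_pow_dvd_qPoch_sub hq N j
  have hu := (isUnit_qPoch (a := q) (q := q) hq k).mul (isUnit_qPoch (a := q) (q := q) hq l)
  rw [← hu.dvd_mul_right]
  have e : (qPoch q q M * qBinom q (k + l) k - 1) * (qPoch q q k * qPoch q q l) =
      (qPoch q q M - qPoch q q N) * qPoch q q (k + l) +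
      qPoch q q N * (qPoch q q (k + l) - qPoch q q N) -
      (qPoch q q k - qPoch q q N) * qPoch q q l -
      qPoch q q N * (qPoch q q l - qPoch q q N) := by
    rw [← qBinom_mul_qPoch q k l]
    ring
  rw [e]
  exact dvd_sub (dvd_sub (dvd_add ((key hM).mul_right _) ((key (by omega)).mul_left _))
    ((key hk).mul_right _)) ((key hl).mul_left _)

/-- The Jacobi triple product identity for formal power series. -/
theorem tendsto_sum_thetaTerm {u v : ℤ⟦X⟧} (hu : PowerSeries.constantCoeff u = 0)
    (hv : PowerSeries.constantCoeff v = 0) :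
    Tendsto (fun N : ℕ => ∑ k ∈ Finset.range (2 * N + 2 * N + 1), thetaTerm u v (k - 2 * N))
      atTop (𝓝 (infPoch u (u * v) * infPoch v (u * v) * infPoch (-(u * v)) (u * v))) := by
  have huv : PowerSeries.constantCoeff (u * v) = 0 := by simp [hu]
  have h2 : Tendsto (fun N : ℕ => 2 * N) atTop atTop :=
    tendsto_id.const_mul_atTop' (show 0 < 2 by norm_num)
  have h3 := (((tendsto_infPoch hu huv).mul (tendsto_infPoch hv huv)).mul
    (tendsto_infPoch (u := -(u * v)) (by simpa using huv) huv)).comp h2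
  have h4 := h3.sub (PowerSeries.tendsto_of_X_pow_dvd (l := 0) (s := fun N =>
    (∏ i ∈ Finset.range (2 * N), (1 + u * (u * v) ^ i)) *
      (∏ i ∈ Finset.range (2 * N), (1 + v * (u * v) ^ i)) *
      (∏ i ∈ Finset.range (2 * N), (1 + -(u * v) * (u * v) ^ i)) -
    ∑ k ∈ Finset.range (2 * N + 2 * N + 1), thetaTerm u v (k - 2 * N)) ?_)
  · simpa [Function.comp_def] using h4
  intro N
  have e : ∏ i ∈ Finset.range (2 * N), (1 + -(u * v) * (u * v) ^ i) =
      qPoch (u * v) (u * v) (2 * N) := Finset.prod_congr rfl fun i _ => by ring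
  rw [sub_zero, finite_triple_product hu, e, Finset.sum_mul, ← Finset.sum_sub_distrib]
  refine Finset.dvd_sum fun k hk => ?_
  rw [Finset.mem_range] at hk
  rw [show qBinom (u * v) (2 * N + 2 * N) k * thetaTerm u v (k - (2 * N : ℕ)) *
    qPoch (u * v) (u * v) (2 * N) - thetaTerm u v (k - 2 * N) =
    (qPoch (u * v) (u * v) (2 * N) * qBinom (u * v) (2 * N + 2 * N) k - 1) *
      thetaTerm u v (k - 2 * N) by push_cast; ring]
  -- Far from the centre the theta term itself is small; near it both indices of the binomial are at
  -- least N. This is why the products are truncated at 2N.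
  by_cases h : N ≤ ((k : ℤ) - 2 * N).natAbs
  · exact (X_pow_dvd_thetaTerm hu hv h).mul_left _
  · refine Dvd.dvd.mul_right ?_ _
    obtain ⟨l, hl⟩ : ∃ l, 2 * N + 2 * N = k + l := ⟨2 * N + 2 * N - k, by omega⟩
    rw [hl]
    exact X_pow_dvd_qPoch_mul_qBinom_sub_one huv (by omega) (by omega) (by omega)

/-! ### Theta series and their product forms. -/

/-- The exponent `a n (n + 1) / 2 + b n (n - 1) / 2` of a theta series. -/
def thetaExp (a b : ℕ) (n : ℤ) : ℕ :=
  a * (n * (n + 1) / 2).toNat + b * (n * (n - 1) / 2).toNat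

theorem two_mul_toNat_triangle (n : ℤ) : 2 * ((n * (n + 1) / 2).toNat : ℤ) = n * (n + 1) := by
  have h2 : 0 ≤ n * (n + 1) := by
    rcases le_or_gt 0 n with h | h <;> nlinarith
  rw [Int.toNat_of_nonneg (by positivity), Int.mul_ediv_cancel' (Int.even_mul_succ_self n).two_dvd]

theorem two_mul_thetaExp (a b : ℕ) (n : ℤ) :
    2 * (thetaExp a b n : ℤ) = a * (n * (n + 1)) + b * (n * (n - 1)) := by
  have h1 := two_mul_toNat_triangle n
  have h2 := two_mul_toNat_triangle (n - 1)
  rw [sub_add_cancel, mul_comm (n - 1)] at h2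
  rw [← h1, ← h2, thetaExp]
  push_cast
  ring

theorem natAbs_le_thetaExp {a b : ℕ} (ha : 0 < a) (hb : 0 < b) (n : ℤ) :
    n.natAbs ≤ thetaExp a b n := by
  have h2 := toNat_triangle_succ (n - 1)
  rw [sub_add_cancel, mul_comm (n - 1) n] at h2
  have h3 := Nat.le_mul_of_pos_left (n * (n + 1) / 2).toNat ha
  have h4 := Nat.le_mul_of_pos_left (n * (n - 1) / 2).toNat hb
  rw [thetaExp]
  omega

theorem coeff_C_mul_X_pow_pow (ε : ℤ) (k m : ℕ) :
    PowerSeries.coeff m ((PowerSeries.C ε * PowerSeries.X) ^ k) = if k = m then ε ^ m else 0 := by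
  rw [mul_pow, ← map_pow, PowerSeries.coeff_C_mul, PowerSeries.coeff_X_pow]
  split_ifs with h1 h2 h2 <;> simp_all

/-- The coefficients of the product side of the Jacobi triple product. -/
theorem coeff_triple_product (ε : ℤ) {a b : ℕ} (ha : 0 < a) (hb : 0 < b) (y : ℤ⟦X⟧)
    (hy : y = PowerSeries.C ε * PowerSeries.X) (m : ℕ) (s : Finset ℤ)
    (hs : ∀ n, thetaExp a b n = m ↔ n ∈ s) :
    PowerSeries.coeff m (infPoch (y ^ a) (y ^ (a + b)) * infPoch (y ^ b) (y ^ (a + b)) *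
      infPoch (-y ^ (a + b)) (y ^ (a + b))) = s.card * ε ^ m := by
  have hy0 : PowerSeries.constantCoeff y = 0 := by simp [hy]
  have h := tendsto_sum_thetaTerm (u := y ^ a) (v := y ^ b) (by simp [hy0, ha.ne'])
    (by simp [hy0, hb.ne'])
  rw [PowerSeries.WithPiTopology.tendsto_iff_coeff_tendsto] at h
  simp only [← pow_add] at h
  refine tendsto_nhds_unique (h m) (tendsto_atTop_of_eventually_const (i₀ := m) fun N hN => ?_)
  have e : ∀ n, PowerSeries.coeff m (thetaTerm (y ^ a) (y ^ b) n) =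
      if n ∈ s then ε ^ m else 0 := by
    intro n
    rw [thetaTerm, ← pow_mul, ← pow_mul, ← pow_add, hy, coeff_C_mul_X_pow_pow]
    exact if_congr (hs n) rfl rfl
  rw [map_sum]
  simp only [e]
  rw [← Finset.sum_filter, Finset.sum_const, nsmul_eq_mul]
  congr 2
  refine Finset.card_nbij' (fun k => (k : ℤ) - 2 * N) (fun n => (n + 2 * N).toNat) ?_ ?_ ?_ ?_
  · intro k hk
    exact (Finset.mem_filter.mp hk).2
  · intro n hn
    have h1 := natAbs_le_thetaExp ha hb n
    rw [(hs n).mpr hn] at h1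
    have h2 : (((n + 2 * N).toNat : ℕ) : ℤ) - 2 * N = n := by omega
    simp only [Finset.coe_filter, Finset.mem_range, Set.mem_ofPred_eq]
    rw [h2]
    exact ⟨by omega, hn⟩
  · intro k hk
    simp
  · intro n hn
    have h1 := natAbs_le_thetaExp ha hb n
    rw [(hs n).mpr hn] at h1
    simp only
    omega

/-- Completing the square turns the count of exponents equal to m into a test whether γm + 1 is a
square. -/
theorem coeff_triple_product_of_sq (ε : ℤ) {a b α γ : ℕ} (ha : 0 < a) (hb : 0 < b) (hα : 3 ≤ α)
    (hγ : 0 < γ) (he : ∀ n, (α * n - 1) ^ 2 = (γ * thetaExp a b n + 1 : ℤ)) (y : ℤ⟦X⟧)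
    (hy : y = PowerSeries.C ε * PowerSeries.X) (m : ℕ)
    (hm : ∀ r : ℤ, r * r = γ * m + 1 → ∃ n : ℤ, α * n - 1 = r ∨ α * n - 1 = -r) :
    PowerSeries.coeff m (infPoch (y ^ a) (y ^ (a + b)) * infPoch (y ^ b) (y ^ (a + b)) *
      infPoch (-y ^ (a + b)) (y ^ (a + b))) =
    ε ^ m * if IsSquare (γ * m + 1) then 1 else 0 := by
  have key : ∀ n, thetaExp a b n = m ↔ (α * n - 1) ^ 2 = (γ * m + 1 : ℤ) := by
    intro n
    rw [he n, add_left_inj, mul_right_inj' (by positivity)]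
    norm_cast
  split_ifs with h
  · obtain ⟨r, hr⟩ := h
    obtain ⟨n₀, hn₀⟩ := hm r (by exact_mod_cast hr.symm)
    have hsq : (α * n₀ - 1) ^ 2 = (γ * m + 1 : ℤ) := by
      have : ((γ : ℤ) * m + 1) = r * r := by exact_mod_cast hr
      rcases hn₀ with h | h <;> rw [h, this] <;> ring
    rw [coeff_triple_product ε ha hb y hy m {n₀}]
    · simp
    intro n
    rw [key, Finset.mem_singleton, ← hsq, sq_eq_sq_iff_eq_or_eq_neg]
    refine ⟨?_, fun h => by simp [h]⟩
    have hα0 : (α : ℤ) ≠ 0 := by positivity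
    rintro (h | h)
    · exact mul_left_cancel₀ hα0 (by linarith)
    -- Opposite roots would give α(n + n₀) = 2, impossible for α ≥ 3; so each exponent occurs at
    -- most once.
    · exfalso
      have h2 : (α : ℤ) ∣ 2 := ⟨n + n₀, by linarith⟩
      have := Int.le_of_dvd (by norm_num) h2
      omega
  · rw [coeff_triple_product ε ha hb y hy m ∅]
    · simp
    intro n
    rw [key]
    simp only [Finset.notMem_empty, iff_false]
    intro h'
    refine h ⟨(α * n - 1).natAbs, ?_⟩
    zify
    rw [abs_mul_abs_self, ← sq, h']

/-- The theta function `φ(ε q) = ∑_{n ∈ ℤ} (ε q)^{n²}`. -/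
noncomputable def thetaPhi (ε : ℤ) : ℤ⟦X⟧ :=
  PowerSeries.mk fun n => ε ^ n * if n = 0 then 1 else if IsSquare n then 2 else 0

/-- The theta function `ψ(q) = ∑_{n ≥ 0} q^{n (n + 1) / 2}`. -/
noncomputable def thetaPsi : ℤ⟦X⟧ :=
  PowerSeries.mk fun n => if IsSquare (8 * n + 1) then 1 else 0

/-- The theta function `f(q, q²) = ∑_{n ∈ ℤ} q^{n (3 n - 1) / 2}`. -/
noncomputable def thetaA : ℤ⟦X⟧ :=
  PowerSeries.mk fun n => if IsSquare (24 * n + 1) then 1 else 0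

/-- The theta function `f(-q, -q⁵) = ∑_{n ∈ ℤ} (-1)^n q^{n (3 n - 2)}`. -/
noncomputable def thetaOmega : ℤ⟦X⟧ :=
  PowerSeries.mk fun n => (-1) ^ n * if IsSquare (3 * n + 1) then 1 else 0

theorem thetaPhi_eq_prod (ε : ℤ) (y : ℤ⟦X⟧) (hy : y = PowerSeries.C ε * PowerSeries.X) :
    thetaPhi ε = infPoch y (y ^ 2) ^ 2 * infPoch (-y ^ 2) (y ^ 2) := by
  ext m
  have key : ∀ n, thetaExp 1 1 n = m ↔ n * n = m := by
    intro n
    have := two_mul_thetaExp 1 1 n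
    push_cast at this
    rw [← @Nat.cast_inj ℤ]
    constructor <;> intro h <;> linarith
  have h := fun s => coeff_triple_product ε one_pos one_pos y hy m s
  simp only [pow_one, key, Nat.reduceAdd] at h
  rw [thetaPhi, PowerSeries.coeff_mk, sq (infPoch _ _), mul_comm]
  split_ifs with h0 h1
  · rw [h {0} (by simp [h0])]
    simp
  · obtain ⟨r, rfl⟩ := h1
    have hr : (r : ℤ) ≠ 0 := by
      rintro h
      simp_all
    rw [h {(r : ℤ), -(r : ℤ)}, Finset.card_pair (by omega)]
    · simp
    intro n
    push_cast
    rw [mul_self_eq_mul_self_iff]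
    simp
  · rw [h ∅]
    · simp
    intro n
    simp only [Finset.notMem_empty, iff_false]
    intro h'
    refine h1 ⟨n.natAbs, ?_⟩
    zify
    rw [abs_mul_abs_self, h']

theorem thetaPsi_eq_prod : thetaPsi = infPoch PowerSeries.X (PowerSeries.X ^ 4) *
    infPoch (PowerSeries.X ^ 3) (PowerSeries.X ^ 4) * eulerProd 4 := by
  ext m
  have h := coeff_triple_product_of_sq 1 (a := 1) (b := 3) (α := 4) (γ := 8) (by norm_num)
    (by norm_num) (by norm_num) (by norm_num) (fun n => ?_) PowerSeries.X (by simp) m ?_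
  · rw [eulerProd, thetaPsi, PowerSeries.coeff_mk]
    simpa using h.symm
  · have := two_mul_thetaExp 1 3 n
    push_cast at this ⊢
    linear_combination (-4) * this
  · intro r hr
    have h4 : r % 4 = 1 ∨ r % 4 = 3 := by
      have h1 : r * r % 2 = 1 := by push_cast at hr; omega
      have : r % 2 = 1 := by
        rcases Int.emod_two_eq_zero_or_one r with h | h <;> simp [Int.mul_emod, h] at h1 ⊢
      omega
    rcases h4 with h | h
    · exact ⟨-(r / 4), by push_cast; omega⟩
    · exact ⟨(r + 1) / 4, by push_cast; omega⟩

theorem thetaA_eq_prod : thetaA = infPoch PowerSeries.X (PowerSeries.X ^ 3) *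
    infPoch (PowerSeries.X ^ 2) (PowerSeries.X ^ 3) * eulerProd 3 := by
  ext m
  have h := coeff_triple_product_of_sq 1 (a := 1) (b := 2) (α := 6) (γ := 24) (by norm_num)
    (by norm_num) (by norm_num) (by norm_num) (fun n => ?_) PowerSeries.X (by simp) m ?_
  · rw [eulerProd, thetaA, PowerSeries.coeff_mk]
    simpa using h.symm
  · have := two_mul_thetaExp 1 2 n
    push_cast at this ⊢
    linear_combination (-12) * this
  · intro r hr
    have h4 : r % 6 = 1 ∨ r % 6 = 5 := by
      have h1 : r * r % 6 = 1 := by push_cast at hr; omega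
      have h2 : 0 ≤ r % 6 ∧ r % 6 < 6 := by omega
      rw [Int.mul_emod] at h1
      generalize r % 6 = t at *
      obtain ⟨h3, h5⟩ := h2
      interval_cases t <;> simp_all
    rcases h4 with h | h
    · exact ⟨-(r / 6), by push_cast; omega⟩
    · exact ⟨(r + 1) / 6, by push_cast; omega⟩

theorem thetaOmega_eq_prod : thetaOmega = infPoch (-PowerSeries.X) (PowerSeries.X ^ 6) *
    infPoch (-PowerSeries.X ^ 5) (PowerSeries.X ^ 6) * eulerProd 6 := by
  ext m
  have h := coeff_triple_product_of_sq (-1) (a := 1) (b := 5) (α := 3) (γ := 3) (by norm_num)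
    (by norm_num) (by norm_num) (by norm_num) (fun n => ?_) (-PowerSeries.X) (by simp) m ?_
  · rw [eulerProd, thetaOmega, PowerSeries.coeff_mk, ← h]
    simp only [Nat.reduceAdd, pow_one, (show Even 6 by decide).neg_pow,
      (show Odd 5 by decide).neg_pow]
  · have := two_mul_thetaExp 1 5 n
    push_cast at this ⊢
    have h2 : (thetaExp 1 5 n : ℤ) = 3 * n ^ 2 - 2 * n := by linarith
    rw [h2]
    ring
  · intro r hr
    have h4 : r % 3 = 1 ∨ r % 3 = 2 := by
      have h1 : r * r % 3 = 1 := by push_cast at hr; omega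
      have : r % 3 ≠ 0 := fun h => by simp [Int.mul_emod, h] at h1
      omega
    rcases h4 with h | h
    · exact ⟨-(r / 3), by push_cast; omega⟩
    · exact ⟨(r + 1) / 3, by push_cast; omega⟩

/-! ### Theta identities through eta quotients. -/

section eta

local notation "F" => eulerProd

theorem infPoch_neg_X_mul : infPoch (-PowerSeries.X) (PowerSeries.X ^ 2) * F 2 = F 1 := by
  simpa using infPoch_odd_mul_eulerProd 1 one_ne_zero

theorem infPoch_X_sq_mul : infPoch PowerSeries.X (PowerSeries.X ^ 2) *
    infPoch (-PowerSeries.X) (PowerSeries.X ^ 2) * F 4 = F 2 := by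
  have := infPoch_odd_mul_eulerProd 2 two_ne_zero
  rw [infPoch_mul_neg (by simp) (by simp), ← this, ← pow_mul]

theorem thetaPhi_one_eq : thetaPhi 1 = infPoch PowerSeries.X (PowerSeries.X ^ 2) ^ 2 * F 2 := by
  rw [thetaPhi_eq_prod 1 PowerSeries.X (by simp), eulerProd]

theorem thetaPhi_neg_one_eq :
    thetaPhi (-1) = infPoch (-PowerSeries.X) (PowerSeries.X ^ 2) ^ 2 * F 2 := by
  rw [thetaPhi_eq_prod (-1) (-PowerSeries.X) (by simp), eulerProd, neg_sq]

theorem thetaPhi_neg_one_mul : thetaPhi (-1) * F 2 = F 1 ^ 2 := by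
  rw [thetaPhi_neg_one_eq, ← infPoch_neg_X_mul]
  ring

theorem thetaPhi_one_mul : thetaPhi 1 * (F 1 ^ 2 * F 4 ^ 2) = F 2 ^ 5 := by
  have h1 := infPoch_neg_X_mul
  have h2 := infPoch_X_sq_mul
  calc _ = (infPoch PowerSeries.X (PowerSeries.X ^ 2) *
      infPoch (-PowerSeries.X) (PowerSeries.X ^ 2) * F 4) ^ 2 * F 2 ^ 3 := by
        rw [thetaPhi_one_eq, ← h1]; ring
    _ = _ := by rw [h2]; ring

theorem thetaPsi_mul : thetaPsi * F 1 = F 2 ^ 2 := by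
  have h := infPoch_split_two (u := PowerSeries.X) (q := PowerSeries.X ^ 2) (by simp) (by simp)
  rw [← pow_mul, ← pow_succ'] at h
  rw [thetaPsi_eq_prod, ← h, ← infPoch_neg_X_mul]
  linear_combination F 2 * infPoch_X_sq_mul

theorem thetaA_mul : thetaA * (F 1 * F 6) = F 2 * F 3 ^ 2 := by
  have h := infPoch_split_three (u := PowerSeries.X) (q := PowerSeries.X) (by simp) (by simp)
  rw [← pow_succ', ← sq] at h
  have h1 := infPoch_pos_mul_eulerProd 1 one_ne_zero
  have h3 := infPoch_pos_mul_eulerProd 3 three_ne_zero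
  norm_num at h1 h3
  rw [thetaA_eq_prod, ← h3, ← h1, h]
  ring

theorem thetaOmega_mul : thetaOmega * (F 2 * F 3) = F 1 * F 6 ^ 2 := by
  have h := infPoch_split_three (u := -PowerSeries.X) (q := PowerSeries.X ^ 2) (by simp) (by simp)
  have h3 := infPoch_odd_mul_eulerProd 3 three_ne_zero
  norm_num at h3
  rw [← pow_mul, ← pow_mul, neg_mul, neg_mul, ← pow_succ', ← pow_succ'] at h
  norm_num at h
  rw [thetaOmega_eq_prod, ← infPoch_neg_X_mul, ← h3, h]
  ring

theorem expand_thetaPhi_neg_one_mul (d : ℕ) (hd : d ≠ 0) :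
    PowerSeries.expand d hd (thetaPhi (-1)) * F (d * 2) = F (d * 1) ^ 2 := by
  have := congrArg (PowerSeries.expand d hd) thetaPhi_neg_one_mul
  rwa [map_mul, map_pow, expand_eulerProd _ _ hd two_ne_zero,
    expand_eulerProd _ _ hd one_ne_zero] at this

theorem expand_thetaPsi_mul (d : ℕ) (hd : d ≠ 0) :
    PowerSeries.expand d hd thetaPsi * F (d * 1) = F (d * 2) ^ 2 := by
  have := congrArg (PowerSeries.expand d hd) thetaPsi_mul
  rwa [map_mul, map_pow, expand_eulerProd _ _ hd two_ne_zero,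
    expand_eulerProd _ _ hd one_ne_zero] at this

theorem thetaPhi_one_mul_thetaPhi_neg_one :
    thetaPhi 1 * thetaPhi (-1) = PowerSeries.expand 2 two_ne_zero (thetaPhi (-1)) ^ 2 := by
  have h1 := thetaPhi_one_mul
  have h2 := thetaPhi_neg_one_mul
  have h3 := expand_thetaPhi_neg_one_mul 2 two_ne_zero
  norm_num at h3
  have n1 := eulerProd_ne_zero 1 one_ne_zero
  have n2 := eulerProd_ne_zero 2 two_ne_zero
  have n4 := eulerProd_ne_zero 4 four_ne_zero
  refine mul_right_cancel₀ (mul_ne_zero (mul_ne_zero (pow_ne_zero 2 n1) (pow_ne_zero 2 n4)) n2) ?_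
  calc _ = (thetaPhi 1 * (F 1 ^ 2 * F 4 ^ 2)) * (thetaPhi (-1) * F 2) := by ring
    _ = (F 2 ^ 2) ^ 2 * F 1 ^ 2 * F 2 := by rw [h1, h2]; ring
    _ = _ := by rw [← h3]; ring

theorem thetaPhi_one_mul_expand_thetaPsi :
    thetaPhi 1 * PowerSeries.expand 2 two_ne_zero thetaPsi = thetaPsi ^ 2 := by
  have h1 := thetaPhi_one_mul
  have h2 := thetaPsi_mul
  have h3 := expand_thetaPsi_mul 2 two_ne_zero
  norm_num at h3
  have n1 := eulerProd_ne_zero 1 one_ne_zero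
  have n2 := eulerProd_ne_zero 2 two_ne_zero
  have n4 := eulerProd_ne_zero 4 four_ne_zero
  refine mul_right_cancel₀ (mul_ne_zero (mul_ne_zero (pow_ne_zero 2 n1) (pow_ne_zero 2 n4)) n2) ?_
  calc _ = (thetaPhi 1 * (F 1 ^ 2 * F 4 ^ 2)) *
        (PowerSeries.expand 2 two_ne_zero thetaPsi * F 2) := by ring
    _ = (F 2 ^ 2) ^ 2 * F 4 ^ 2 * F 2 := by rw [h1, h3]; ring
    _ = _ := by rw [← h2]; ring

/-- The product AΩ is a series in q³; this is what makes the cross terms of the 3-dissections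
combine. -/
theorem thetaA_mul_thetaOmega :
    thetaA * thetaOmega = PowerSeries.expand 3 three_ne_zero thetaPsi *
      PowerSeries.expand 3 three_ne_zero (thetaPhi (-1)) := by
  have h1 := thetaA_mul
  have h2 := thetaOmega_mul
  have h3 := expand_thetaPsi_mul 3 three_ne_zero
  have h4 := expand_thetaPhi_neg_one_mul 3 three_ne_zero
  norm_num at h3 h4
  have n1 := eulerProd_ne_zero 1 one_ne_zero
  have n2 := eulerProd_ne_zero 2 two_ne_zero
  have n3 := eulerProd_ne_zero 3 three_ne_zero
  have n6 := eulerProd_ne_zero 6 (by norm_num)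
  refine mul_right_cancel₀ (mul_ne_zero (mul_ne_zero n1 n2) (mul_ne_zero n3 n6)) ?_
  calc _ = (thetaA * (F 1 * F 6)) * (thetaOmega * (F 2 * F 3)) := by ring
    _ = F 6 ^ 2 * F 3 ^ 2 * (F 1 * F 2) := by rw [h1, h2]; ring
    _ = _ := by rw [← h3, ← h4]; ring

theorem thetaA_pow_three_mul :
    thetaA ^ 3 * thetaPhi (-1) =
      PowerSeries.expand 3 three_ne_zero (thetaPhi (-1)) ^ 3 * thetaPsi := by
  have h1 := thetaA_mul
  have h2 := thetaPhi_neg_one_mul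
  have h3 := thetaPsi_mul
  have h4 := expand_thetaPhi_neg_one_mul 3 three_ne_zero
  norm_num at h4
  have n1 := eulerProd_ne_zero 1 one_ne_zero
  have n2 := eulerProd_ne_zero 2 two_ne_zero
  have n6 := eulerProd_ne_zero 6 (by norm_num)
  refine mul_right_cancel₀ (mul_ne_zero (mul_ne_zero (pow_ne_zero 3 n1) (pow_ne_zero 3 n6)) n2) ?_
  calc _ = (thetaA * (F 1 * F 6)) ^ 3 * (thetaPhi (-1) * F 2) := by ring
    _ = F 2 ^ 2 * (F 3 ^ 2) ^ 3 * (F 1 ^ 2 * F 2) := by rw [h1, h2]; ring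
    _ = _ := by rw [← h3, ← h4]; ring

/-- Expresses (-q; q²)_∞ / (q; q²)_∞ as φ(q)/φ(-q²); with q² for q, this is the product produced by
iterating the difference equation. -/
theorem thetaPhi_one_mul_infPoch :
    thetaPhi 1 * infPoch (-PowerSeries.X) (PowerSeries.X ^ 2) =
      PowerSeries.expand 2 two_ne_zero (thetaPhi (-1)) *
        infPoch PowerSeries.X (PowerSeries.X ^ 2) := by
  have h1 := infPoch_X_sq_mul
  have h3 := expand_thetaPhi_neg_one_mul 2 two_ne_zero
  norm_num at h3
  have n4 := eulerProd_ne_zero 4 four_ne_zero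
  refine mul_right_cancel₀ n4 ?_
  calc _ = infPoch PowerSeries.X (PowerSeries.X ^ 2) * F 2 *
        (infPoch PowerSeries.X (PowerSeries.X ^ 2) *
          infPoch (-PowerSeries.X) (PowerSeries.X ^ 2) * F 4) := by rw [thetaPhi_one_eq]; ring
    _ = F 2 ^ 2 * infPoch PowerSeries.X (PowerSeries.X ^ 2) := by rw [h1]; ring
    _ = _ := by rw [← h3]; ring

end eta

/-! ### The deformed series, its difference equation, and ∑ v₀(2n) qⁿ. -/

section bilateral

local notation "𝔮" => (PowerSeries.X : ℤ⟦X⟧)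

/-- The terms of a one-parameter deformation of the series defining `v0`; the parameter `-𝔮`
gives `v0Term`. -/
noncomputable def deformTerm (t : ℤ⟦X⟧) : ℕ → ℤ⟦X⟧
  | 0 => 1
  | n + 1 => 𝔮 ^ (2 * n) * (𝔮 ^ (2 * n + 2) - t) * deformTerm t n *
      PowerSeries.invOfUnit (1 + t * 𝔮 ^ (2 * n)) 1

/-- The auxiliary sequence through which the sum of `deformTerm` telescopes. -/
noncomputable def deformAux (t : ℤ⟦X⟧) : ℕ → ℤ⟦X⟧
  | 0 => 1
  | n + 1 => 𝔮 ^ (2 * n) * (𝔮 ^ (2 * n) - t) * deformAux t n *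
      PowerSeries.invOfUnit (1 + t * 𝔮 ^ (2 * n + 2)) 1

variable {t : ℤ⟦X⟧}


theorem one_add_mul_ne_zero (ht : PowerSeries.constantCoeff t = 0) (x : ℤ⟦X⟧) : 1 + t * x ≠ 0 := by
  intro h
  have := congrArg PowerSeries.constantCoeff h
  simp [ht] at this

theorem deformTerm_succ (ht : PowerSeries.constantCoeff t = 0) (n : ℕ) :
    deformTerm t (n + 1) * (1 + t * 𝔮 ^ (2 * n)) =
      𝔮 ^ (2 * n) * (𝔮 ^ (2 * n + 2) - t) * deformTerm t n := by
  rw [deformTerm, mul_assoc _ (PowerSeries.invOfUnit _ _),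
    PowerSeries.invOfUnit_mul _ _ (by simp [ht]), mul_one]

theorem deformAux_succ (ht : PowerSeries.constantCoeff t = 0) (n : ℕ) :
    deformAux t (n + 1) * (1 + t * 𝔮 ^ (2 * n + 2)) =
      𝔮 ^ (2 * n) * (𝔮 ^ (2 * n) - t) * deformAux t n := by
  rw [deformAux, mul_assoc _ (PowerSeries.invOfUnit _ _),
    PowerSeries.invOfUnit_mul _ _ (by simp [ht]), mul_one]

theorem deformTerm_mul_sq (ht : PowerSeries.constantCoeff t = 0) (n : ℕ) :
    deformTerm (t * 𝔮 ^ 2) n = 𝔮 ^ (2 * n) * deformAux t n := by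
  induction n with
  | zero => simp [deformTerm, deformAux]
  | succ n ih =>
    have h1 := deformTerm_succ (t := t * 𝔮 ^ 2) (by simp [ht]) n
    have h2 := deformAux_succ ht n
    refine mul_right_cancel₀ (one_add_mul_ne_zero ht (𝔮 ^ (2 * n + 2))) ?_
    rw [show t * 𝔮 ^ 2 * 𝔮 ^ (2 * n) = t * 𝔮 ^ (2 * n + 2) by ring] at h1
    rw [h1, ih]
    linear_combination (-PowerSeries.X ^ (2 * n + 2)) * h2

theorem one_sub_sq_mul_deformTerm (ht : PowerSeries.constantCoeff t = 0) (n : ℕ) :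
    (1 - t ^ 2) * deformTerm t n = (𝔮 ^ (2 * n) - t) * (1 + t * 𝔮 ^ (2 * n)) * deformAux t n := by
  induction n with
  | zero => simp [deformTerm, deformAux]; ring
  | succ n ih =>
    have h1 := deformTerm_succ ht n
    have h2 := deformAux_succ ht n
    refine mul_right_cancel₀ (one_add_mul_ne_zero ht (𝔮 ^ (2 * n))) ?_
    rw [mul_assoc, h1, show (1 - t ^ 2) * (𝔮 ^ (2 * n) * (𝔮 ^ (2 * n + 2) - t) * deformTerm t n) =
      𝔮 ^ (2 * n) * (𝔮 ^ (2 * n + 2) - t) * ((1 - t ^ 2) * deformTerm t n) by ring, ih]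
    linear_combination (-(𝔮 ^ (2 * n + 2) - t) * (1 + t * 𝔮 ^ (2 * n))) * h2

/-- Both summands are multiples of `deformAux t n`, and t(1 + t q^{2n}) `deformAux t n` drops by
exactly their difference. -/
theorem sum_deformTerm_mul_sq (ht : PowerSeries.constantCoeff t = 0) (N : ℕ) :
    (1 + t ^ 2) * ∑ n ∈ Finset.range N, deformTerm (t * 𝔮 ^ 2) n =
      (1 - t ^ 2) * ∑ n ∈ Finset.range N, deformTerm t n +
        t * ((1 + t) - (1 + t * 𝔮 ^ (2 * N)) * deformAux t N) := by
  induction N with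
  | zero => simp [deformAux]
  | succ N ih =>
    rw [Finset.sum_range_succ, Finset.sum_range_succ, mul_add, mul_add, ih,
      one_sub_sq_mul_deformTerm ht, deformTerm_mul_sq ht]
    linear_combination t * deformAux_succ ht N

theorem X_pow_dvd_deformTerm_succ (t : ℤ⟦X⟧) (n : ℕ) : 𝔮 ^ n ∣ deformTerm t (n + 1) := by
  rw [deformTerm, mul_assoc, mul_assoc]
  exact (pow_dvd_pow _ (by omega)).mul_right _

theorem X_pow_dvd_deformAux_succ (t : ℤ⟦X⟧) (n : ℕ) : 𝔮 ^ n ∣ deformAux t (n + 1) := by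
  rw [deformAux, mul_assoc, mul_assoc]
  exact (pow_dvd_pow _ (by omega)).mul_right _

theorem exists_deformSum (t : ℤ⟦X⟧) : ∃ l : ℤ⟦X⟧,
    ∀ n, 𝔮 ^ n ∣ (∑ k ∈ Finset.range (n + 1), deformTerm t k) - l := by
  refine PowerSeries.exists_X_pow_dvd_of_succ fun n => ?_
  rw [Finset.sum_range_succ, add_sub_cancel_left]
  exact X_pow_dvd_deformTerm_succ t n

theorem dvd_deformTerm_sub (ht : PowerSeries.constantCoeff t = 0) (n : ℕ) :
    t ∣ deformTerm t n - (𝔮 ^ 2) ^ (n * n) := by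
  induction n with
  | zero => simp [deformTerm]
  | succ n ih =>
    have hu : IsUnit (1 + t * 𝔮 ^ (2 * n)) := by
      rw [PowerSeries.isUnit_iff_constantCoeff]
      simp [ht]
    rw [← hu.dvd_mul_right, sub_mul, deformTerm_succ ht]
    obtain ⟨c, hc⟩ := ih
    rw [sub_eq_iff_eq_add] at hc
    refine ⟨𝔮 ^ (2 * n) * (𝔮 ^ (2 * n + 2) - t) * c - 𝔮 ^ (2 * n) * (𝔮 ^ 2) ^ (n * n) -
      (𝔮 ^ 2) ^ ((n + 1) * (n + 1)) * 𝔮 ^ (2 * n), ?_⟩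
    rw [hc]
    ring


/-- The sum of `deformTerm`. -/
noncomputable def deformSum (t : ℤ⟦X⟧) : ℤ⟦X⟧ :=
  (exists_deformSum t).choose


theorem X_pow_dvd_sum_deformTerm_sub (t : ℤ⟦X⟧) (n : ℕ) :
    𝔮 ^ n ∣ (∑ k ∈ Finset.range (n + 1), deformTerm t k) - deformSum t :=
  (exists_deformSum t).choose_spec n

theorem tendsto_deformSum (t : ℤ⟦X⟧) :
    Tendsto (fun n => ∑ k ∈ Finset.range (n + 1), deformTerm t k) atTop (𝓝 (deformSum t)) :=
  PowerSeries.tendsto_of_X_pow_dvd (X_pow_dvd_sum_deformTerm_sub t)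

theorem deformSum_mul_sq (ht : PowerSeries.constantCoeff t = 0) :
    (1 + t ^ 2) * deformSum (t * 𝔮 ^ 2) = (1 - t ^ 2) * deformSum t + t * (1 + t) := by
  have h1 := (tendsto_deformSum (t * 𝔮 ^ 2)).const_mul (1 + t ^ 2)
  have h2 := (tendsto_deformSum t).const_mul (1 - t ^ 2)
  have h3 : Tendsto (fun N => (1 + t * 𝔮 ^ (2 * (N + 1))) * deformAux t (N + 1)) atTop (𝓝 0) :=
    PowerSeries.tendsto_of_X_pow_dvd fun n => by
      rw [sub_zero]
      exact (X_pow_dvd_deformAux_succ t n).mul_left _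
  have h4 := h2.add ((h3.const_sub (1 + t)).const_mul t)
  rw [sub_zero] at h4
  exact tendsto_nhds_unique h1 (h4.congr fun N => (sum_deformTerm_mul_sq ht (N + 1)).symm)


/-- The even part of the deformed series. -/
noncomputable def deformEven (m : ℕ) : ℤ⟦X⟧ :=
  deformSum (𝔮 ^ (2 * m + 1)) + deformSum (-𝔮 ^ (2 * m + 1)) - 1

/-- At ±t the inhomogeneous terms t(1 + t) and -t(1 - t) add up to 2t², which the constant -1 in
`deformEven` absorbs. -/
theorem deformEven_succ (m : ℕ) :
    (1 + 𝔮 ^ (4 * m + 2)) * deformEven (m + 1) = (1 - 𝔮 ^ (4 * m + 2)) * deformEven m := by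
  have h1 := deformSum_mul_sq (t := 𝔮 ^ (2 * m + 1)) (by simp)
  have h2 := deformSum_mul_sq (t := -𝔮 ^ (2 * m + 1)) (by simp)
  rw [neg_mul] at h2
  rw [← pow_add] at h1 h2
  rw [deformEven, deformEven, show 2 * (m + 1) + 1 = 2 * m + 1 + 2 by ring]
  linear_combination h1 + h2

theorem prod_mul_deformEven (m : ℕ) :
    (∏ i ∈ Finset.range m, (1 + 𝔮 ^ 2 * (𝔮 ^ 4) ^ i)) * deformEven m =
      (∏ i ∈ Finset.range m, (1 + -𝔮 ^ 2 * (𝔮 ^ 4) ^ i)) * deformEven 0 := by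
  induction m with
  | zero => simp
  | succ m ih =>
    rw [Finset.prod_range_succ, Finset.prod_range_succ]
    have h := deformEven_succ m
    calc _ = (∏ i ∈ Finset.range m, (1 + 𝔮 ^ 2 * (𝔮 ^ 4) ^ i)) *
          ((1 + 𝔮 ^ (4 * m + 2)) * deformEven (m + 1)) := by ring
      _ = (1 - 𝔮 ^ (4 * m + 2)) *
          ((∏ i ∈ Finset.range m, (1 + 𝔮 ^ 2 * (𝔮 ^ 4) ^ i)) * deformEven m) := by rw [h]; ring
      _ = _ := by rw [ih]; ring

theorem tendsto_sum_X_pow_sq :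
    Tendsto (fun N : ℕ => 2 * ∑ n ∈ Finset.range (N + 1), 𝔮 ^ (n * n) - 1) atTop
      (𝓝 (thetaPhi 1)) := by
  refine PowerSeries.tendsto_of_X_pow_dvd fun N => PowerSeries.X_pow_dvd_iff.mpr fun m hm => ?_
  rw [map_sub, map_sub, sub_eq_zero, thetaPhi, PowerSeries.coeff_mk, two_mul, map_add, map_sum]
  simp only [PowerSeries.coeff_X_pow, PowerSeries.coeff_one, one_pow, one_mul]
  by_cases h : IsSquare m
  · obtain ⟨r, rfl⟩ := h
    have hr : r < N + 1 := by nlinarith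
    have e : ∑ n ∈ Finset.range (N + 1), (if r * r = n * n then (1 : ℤ) else 0) = 1 := by
      rw [Finset.sum_eq_single_of_mem r (Finset.mem_range.mpr hr)]
      · simp
      · intro n _ hn
        rw [if_neg]
        exact fun h => hn (Nat.mul_self_inj.mp h).symm
    rw [e]
    by_cases h0 : r = 0 <;> simp [h0]
  · rw [Finset.sum_eq_zero]
    · have h0 : m ≠ 0 := by
        rintro rfl
        exact h ⟨0, rfl⟩
      simp [h0, h]
    · intro n _
      rw [if_neg]
      exact fun h' => h ⟨n, h'⟩

/-- As t = ±q^{2m+1} tends to 0, the n-th term tends to q^{2n²}, so the limit is 2∑q^{2n²} - 1 =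
φ(q²). -/
theorem tendsto_deformEven :
    Tendsto deformEven atTop (𝓝 (PowerSeries.expand 2 two_ne_zero (thetaPhi 1))) := by
  have h := PowerSeries.tendsto_expand tendsto_sum_X_pow_sq 2 two_ne_zero
  have h0 : Tendsto (fun N => deformEven N - PowerSeries.expand 2 two_ne_zero
      (2 * ∑ n ∈ Finset.range (N + 1), 𝔮 ^ (n * n) - 1)) atTop (𝓝 0) := by
    refine PowerSeries.tendsto_of_X_pow_dvd fun N => ?_
    have key : ∀ t : ℤ⟦X⟧, PowerSeries.constantCoeff t = 0 → 𝔮 ^ N ∣ t →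
        𝔮 ^ N ∣ deformSum t - ∑ n ∈ Finset.range (N + 1), (𝔮 ^ 2) ^ (n * n) := by
      intro t ht hN
      have h1 := X_pow_dvd_sum_deformTerm_sub t N
      have h2 : t ∣ ∑ k ∈ Finset.range (N + 1), (deformTerm t k - (𝔮 ^ 2) ^ (k * k)) :=
        Finset.dvd_sum fun k _ => dvd_deformTerm_sub ht k
      rw [Finset.sum_sub_distrib] at h2
      have := dvd_sub (hN.trans h2) h1
      rwa [sub_sub_sub_cancel_left] at this
    have hd : 𝔮 ^ N ∣ 𝔮 ^ (2 * N + 1) := pow_dvd_pow _ (by omega)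
    have h1 := dvd_add (key (𝔮 ^ (2 * N + 1)) (by simp) hd)
      (key (-𝔮 ^ (2 * N + 1)) (by simp) ((dvd_neg).mpr hd))
    convert h1 using 1
    simp only [deformEven, map_sub, map_mul, map_sum, map_pow, PowerSeries.expand_X, map_one,
      map_ofNat]
    ring
  simpa using h0.add h

theorem infPoch_mul_deformEven_zero :
    infPoch (-𝔮 ^ 2) (𝔮 ^ 4) * deformEven 0 =
      infPoch (𝔮 ^ 2) (𝔮 ^ 4) * PowerSeries.expand 2 two_ne_zero (thetaPhi 1) :=
  tendsto_nhds_unique ((tendsto_infPoch (by simp) (by simp)).mul_const _)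
    (((tendsto_infPoch (by simp) (by simp)).mul tendsto_deformEven).congr prod_mul_deformEven)

theorem deformEven_zero_mul :
    deformEven 0 * PowerSeries.expand 4 four_ne_zero (thetaPhi (-1)) =
      PowerSeries.expand 2 two_ne_zero (thetaPhi 1) ^ 2 := by
  have h1 := congrArg (PowerSeries.expand 2 two_ne_zero) thetaPhi_one_mul_infPoch
  have h2 := infPoch_mul_deformEven_zero
  rw [map_mul, map_mul, expand_infPoch (by simp) (by simp), expand_infPoch (by simp) (by simp),
    ← PowerSeries.expand_mul] at h1
  simp only [map_neg, map_pow, PowerSeries.expand_X, ← pow_mul, Nat.reduceMul] at h1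
  have hne : infPoch (-𝔮 ^ 2) (𝔮 ^ 4) ≠ 0 := by
    intro h
    have := constantCoeff_infPoch (u := -𝔮 ^ 2) (q := 𝔮 ^ 4) (by simp) (by simp)
    simp [h] at this
  refine mul_left_cancel₀ hne ?_
  linear_combination PowerSeries.expand 4 four_ne_zero (thetaPhi (-1)) * h2 -
    PowerSeries.expand 2 two_ne_zero (thetaPhi 1) * h1

theorem v0Term_eq_deformTerm (n : ℕ) : v0Term n = deformTerm (-𝔮) n := by
  have hne : ∀ n, qPoch 𝔮 (𝔮 ^ 2) n ≠ 0 := fun n => (isUnit_qPoch (by simp) n).ne_zero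
  refine mul_right_cancel₀ (hne n) ?_
  rw [v0Term_mul]
  induction n with
  | zero => simp [qPoch, deformTerm]
  | succ n ih =>
    have h := deformTerm_succ (t := -𝔮) (by simp) n
    rw [qPoch_succ, qPoch_succ, ← mul_assoc (deformTerm _ _), mul_right_comm,
      show 1 - 𝔮 * (𝔮 ^ 2) ^ n = 1 + -𝔮 * 𝔮 ^ (2 * n) by ring, h]
    calc _ = 𝔮 ^ (2 * n + 1) * (1 + 𝔮 ^ (2 * n + 1)) *
          (𝔮 ^ n ^ 2 * qPoch (-𝔮) (𝔮 ^ 2) n) := by ring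
      _ = _ := by rw [ih]; ring

theorem deformSum_neg_X : deformSum (-𝔮) = PowerSeries.mk v0 :=
  tendsto_nhds_unique (tendsto_deformSum _)
    (((hasSum_v0Term.tendsto_sum_nat).comp (tendsto_add_atTop_nat 1)).congr fun _ =>
      Finset.sum_congr rfl fun k _ => v0Term_eq_deformTerm k)

theorem PowerSeries.tendsto_evalNegHom {s : ℕ → ℤ⟦X⟧} {l : ℤ⟦X⟧} (h : Tendsto s atTop (𝓝 l)) :
    Tendsto (fun n => PowerSeries.evalNegHom (s n)) atTop (𝓝 (PowerSeries.evalNegHom l)) := by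
  rw [PowerSeries.WithPiTopology.tendsto_iff_coeff_tendsto] at h ⊢
  intro m
  simp only [PowerSeries.evalNegHom, PowerSeries.coeff_rescale]
  exact (h m).const_mul _

theorem evalNegHom_deformTerm (n : ℕ) :
    PowerSeries.evalNegHom (deformTerm (-𝔮) n) = deformTerm 𝔮 n := by
  induction n with
  | zero => simp [deformTerm]
  | succ n ih =>
    have h1 := congrArg PowerSeries.evalNegHom (deformTerm_succ (t := -𝔮) (by simp) n)
    have h2 := deformTerm_succ (t := 𝔮) (by simp) n
    refine mul_right_cancel₀ (one_add_mul_ne_zero (t := 𝔮) (by simp) (𝔮 ^ (2 * n))) ?_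
    rw [h2, ← ih]
    simpa [PowerSeries.evalNegHom_X, pow_add, pow_mul, sub_eq_add_neg] using h1

theorem deformSum_X : deformSum 𝔮 = PowerSeries.evalNegHom (PowerSeries.mk v0) := by
  rw [← deformSum_neg_X]
  refine tendsto_nhds_unique (tendsto_deformSum _) ((PowerSeries.tendsto_evalNegHom
    (tendsto_deformSum (-𝔮))).congr fun _ => ?_)
  rw [map_sum]
  exact Finset.sum_congr rfl fun k _ => evalNegHom_deformTerm k

/-- The generating function of `v0 (2 n)` is an eta quotient. -/
theorem two_mul_mk_v0_two_mul :
    (2 * PowerSeries.mk (fun n => v0 (2 * n)) - 1) *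
      PowerSeries.expand 2 two_ne_zero (thetaPhi (-1)) = thetaPhi 1 ^ 2 := by
  -- At t = ±q the two sums are the generating function at -q and q, so the odd coefficients cancel.
  have h : deformEven 0 = PowerSeries.expand 2 two_ne_zero
      (2 * PowerSeries.mk (fun n => v0 (2 * n)) - 1) := by
    rw [deformEven, mul_zero, zero_add, pow_one, deformSum_X, deformSum_neg_X, map_sub, map_one,
      sub_left_inj]
    ext n
    rw [PowerSeries.coeff_expand, map_add, PowerSeries.evalNegHom, PowerSeries.coeff_rescale,
      PowerSeries.coeff_mk, two_mul]
    split_ifs with hn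
    · obtain ⟨k, rfl⟩ := hn
      simp [pow_mul]
    · rw [(Nat.not_even_iff_odd.mp (mt Even.two_dvd hn)).neg_one_pow]
      ring
  have h4 := deformEven_zero_mul
  rw [h, PowerSeries.expand_mul 2 two_ne_zero 2 two_ne_zero, ← map_mul, ← map_pow] at h4
  ext n
  have := congrArg (PowerSeries.coeff (2 * n)) h4
  simpa only [PowerSeries.coeff_expand_mul] using this

end bilateral

/-! ### 2- and 3-dissections of theta functions, up to ∑ v₀(32n+4) qⁿ. -/

section dissection

open PowerSeries (X coeff expand mk)

/-- The power series of the coefficients of index congruent to `r` modulo `d`. -/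
noncomputable def sect (d r : ℕ) : ℤ⟦X⟧ →+ ℤ⟦X⟧ where
  toFun f := mk fun n => coeff (d * n + r) f
  map_zero' := by ext; simp
  map_add' f g := by ext; simp

theorem coeff_sect (d r n : ℕ) (f : ℤ⟦X⟧) : coeff n (sect d r f) = coeff (d * n + r) f :=
  PowerSeries.coeff_mk n fun n => coeff (d * n + r) f

theorem sect_expand_mul {d r : ℕ} (hd : d ≠ 0) (hr : r < d) (g f : ℤ⟦X⟧) :
    sect d r (expand d hd g * f) = g * sect d r f := by
  ext n
  rw [coeff_sect, PowerSeries.coeff_mul, PowerSeries.coeff_mul]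
  symm
  refine Finset.sum_of_injOn (fun p => (d * p.1, d * p.2 + r)) ?_ ?_ ?_ ?_
  · rintro ⟨a, b⟩ _ ⟨a', b'⟩ _ h
    simp only [Prod.mk.injEq, Nat.add_right_cancel_iff] at h
    rw [Prod.mk.injEq]
    exact ⟨Nat.eq_of_mul_eq_mul_left (Nat.pos_of_ne_zero hd) h.1,
      Nat.eq_of_mul_eq_mul_left (Nat.pos_of_ne_zero hd) h.2⟩
  · rintro ⟨a, b⟩ h
    simp only [Finset.mem_coe, Finset.HasAntidiagonal.mem_antidiagonal] at h ⊢
    rw [← h]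
    ring
  · rintro ⟨a, b⟩ h h'
    rw [PowerSeries.coeff_expand]
    split_ifs with hdvd
    · exfalso
      obtain ⟨c, rfl⟩ := hdvd
      rw [Finset.HasAntidiagonal.mem_antidiagonal] at h
      refine h' ⟨(c, n - c), ?_, ?_⟩
      · have : d * c < d * (n + 1) := by rw [mul_add]; omega
        have := Nat.lt_of_mul_lt_mul_left this
        simp only [Finset.mem_coe, Finset.HasAntidiagonal.mem_antidiagonal]
        omega
      · have : d * c < d * (n + 1) := by rw [mul_add]; omega
        have := Nat.lt_of_mul_lt_mul_left this
        simp only [Prod.mk.injEq, true_and]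
        simp only at h
        obtain ⟨e, rfl⟩ := Nat.exists_eq_add_of_le (Nat.lt_succ_iff.mp this)
        rw [Nat.add_sub_cancel_left]
        rw [mul_add] at h
        omega
    · rw [zero_mul]
  · rintro ⟨a, b⟩ _
    rw [PowerSeries.coeff_expand_mul, coeff_sect]

theorem sect_X_pow_mul_expand {d r s : ℕ} (j : ℕ) (hd : d ≠ 0) (hr : r < d) (hs : s < d)
    (f : ℤ⟦X⟧) :
    sect d r (X ^ (d * j + s) * expand d hd f) = if s = r then X ^ j * f else 0 := by
  have h : sect d r (X ^ s) = if s = r then 1 else 0 := by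
    ext n
    rw [coeff_sect, PowerSeries.coeff_X_pow]
    rcases Nat.eq_zero_or_pos n with rfl | hn
    · by_cases h : s = r
      · simp [h]
      · rw [if_neg (by omega), if_neg h, map_zero]
    · have := Nat.le_mul_of_pos_right d hn
      rw [if_neg (by omega)]
      split_ifs
      · rw [PowerSeries.coeff_one, if_neg hn.ne']
      · rw [map_zero]
  have e : X ^ (d * j + s) * expand d hd f = expand d hd (X ^ j * f) * X ^ s := by
    rw [map_mul, map_pow, PowerSeries.expand_X]
    ring
  rw [e, sect_expand_mul hd hr, h]
  split_ifs <;> simp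

theorem expand_injective {d : ℕ} (hd : d ≠ 0) : Function.Injective (expand d hd (R := ℤ)) := by
  intro f g h
  ext n
  simpa only [PowerSeries.coeff_expand_mul] using congrArg (coeff (d * n)) h

theorem expand_expand {a b c : ℕ} (ha : a ≠ 0) (hb : b ≠ 0) (hc : c ≠ 0) (h : a * b = c)
    (f : ℤ⟦X⟧) : expand a ha (expand b hb f) = expand c hc f := by
  subst h
  rw [PowerSeries.expand_mul]

theorem evalNegHom_expand {d : ℕ} (hd : d ≠ 0) (he : Even d) (f : ℤ⟦X⟧) :
    PowerSeries.evalNegHom (expand d hd f) = expand d hd f := by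
  ext n
  rw [PowerSeries.evalNegHom, PowerSeries.coeff_rescale, PowerSeries.coeff_expand]
  split_ifs with h
  · obtain ⟨k, rfl⟩ := h
    rw [(he.mul_right k).neg_one_pow, one_mul]
  · rw [mul_zero]

theorem evalNegHom_thetaPhi (ε : ℤ) : PowerSeries.evalNegHom (thetaPhi ε) = thetaPhi (-ε) := by
  ext n
  rw [PowerSeries.evalNegHom, PowerSeries.coeff_rescale, thetaPhi, thetaPhi, PowerSeries.coeff_mk,
    PowerSeries.coeff_mk, ← mul_assoc, ← mul_pow, neg_one_mul]

/-- Even squares are 4s²; odd squares are 1 + 8 times a triangular number. -/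
theorem thetaPhi_one_dissection :
    thetaPhi 1 = expand 4 four_ne_zero (thetaPhi 1) +
      2 * X * expand 8 (by norm_num) thetaPsi := by
  ext n
  rw [map_add, mul_assoc, ← map_ofNat PowerSeries.C 2, PowerSeries.coeff_C_mul]
  rcases n with _ | k
  · simp [thetaPhi]
  rw [PowerSeries.coeff_succ_X_mul, PowerSeries.coeff_expand, PowerSeries.coeff_expand, thetaPhi,
    thetaPsi, PowerSeries.coeff_mk, PowerSeries.coeff_mk, PowerSeries.coeff_mk, one_pow, one_pow,
    one_mul, one_mul, if_neg (Nat.succ_ne_zero k)]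
  by_cases h4 : 4 ∣ k + 1
  · rw [if_pos h4, if_neg (c := 8 ∣ k) (by omega), mul_zero, add_zero,
      if_neg (c := (k + 1) / 4 = 0) (by omega)]
    obtain ⟨m, hm⟩ := h4
    rw [hm, Nat.mul_div_cancel_left _ (by norm_num)]
    refine if_congr ⟨?_, ?_⟩ rfl rfl
    · rintro ⟨r, hr⟩
      have h2 : Even (r * r) := ⟨2 * m, by omega⟩
      obtain ⟨s, rfl⟩ := (Nat.even_mul.mp h2).elim id id
      exact ⟨s, by nlinarith⟩
    · rintro ⟨s, rfl⟩
      exact ⟨2 * s, by ring⟩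
  rw [if_neg h4, zero_add]
  by_cases h8 : 8 ∣ k
  · obtain ⟨m, rfl⟩ := h8
    rw [if_pos (dvd_mul_right _ _), Nat.mul_div_cancel_left _ (by norm_num)]
    split_ifs <;> rfl
  · rw [if_neg h8, mul_zero, if_neg]
    rintro ⟨r, hr⟩
    rcases Nat.even_or_odd' r with ⟨s, rfl | rfl⟩
    · exact h4 ⟨s * s, by rw [hr]; ring⟩
    · obtain ⟨t, ht⟩ := (Nat.even_mul_succ_self s).two_dvd
      exact h8 ⟨t, by nlinarith⟩

/-- If 3 ∤ n and 8n + 1 is a square, its root is divisible by 3, so n = 9m + 1 with 8m + 1 a square.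
-/
theorem thetaPsi_dissection :
    thetaPsi = expand 3 three_ne_zero thetaA + X * expand 9 (by norm_num) thetaPsi := by
  ext n
  rw [map_add, PowerSeries.coeff_expand]
  have hX : coeff n (X * expand 9 (by norm_num) thetaPsi) =
      if n % 9 = 1 ∧ IsSquare (8 * (n / 9) + 1) then 1 else 0 := by
    rcases n with _ | k
    · simp
    rw [PowerSeries.coeff_succ_X_mul, PowerSeries.coeff_expand, thetaPsi, PowerSeries.coeff_mk]
    by_cases h : 9 ∣ k
    · rw [if_pos h, show (k + 1) / 9 = k / 9 by omega]
      exact if_congr ⟨fun h' => ⟨by omega, h'⟩, fun h' => h'.2⟩ rfl rfl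
    · rw [if_neg h, if_neg]
      rintro ⟨h1, _⟩
      omega
  rw [hX, thetaPsi, thetaA, PowerSeries.coeff_mk, PowerSeries.coeff_mk]
  by_cases h3 : 3 ∣ n
  · rw [if_pos h3, if_neg (c := _ ∧ _) (by omega), add_zero]
    obtain ⟨m, rfl⟩ := h3
    rw [Nat.mul_div_cancel_left _ (by norm_num), show 8 * (3 * m) = 24 * m by ring]
  rw [if_neg h3, zero_add]
  refine if_congr ⟨?_, ?_⟩ rfl rfl
  · rintro ⟨r, hr⟩
    have h0 : r % 3 = 0 := by
      have h1 : r * r % 3 = (8 * n + 1) % 3 := by rw [hr]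
      have h2 : r % 3 < 3 := Nat.mod_lt _ (by norm_num)
      rw [Nat.mul_mod] at h1
      generalize r % 3 = t at *
      interval_cases t
      · rfl
      · omega
      · omega
    obtain ⟨s, rfl⟩ := Nat.dvd_of_mod_eq_zero h0
    have h9 : 8 * n + 1 = 9 * (s * s) := by rw [hr]; ring
    exact ⟨by omega, s, by omega⟩
  · rintro ⟨h1, s, hs⟩
    refine ⟨3 * s, ?_⟩
    rw [show 3 * s * (3 * s) = 9 * (s * s) by ring, ← hs]
    omega

theorem thetaPhi_neg_one_dissection :
    thetaPhi (-1) = expand 9 (by norm_num) (thetaPhi (-1)) -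
      2 * X * expand 3 three_ne_zero thetaOmega := by
  ext n
  rw [map_sub, mul_assoc, ← map_ofNat PowerSeries.C 2, PowerSeries.coeff_C_mul]
  rcases n with _ | k
  · simp [thetaPhi]
  rw [PowerSeries.coeff_succ_X_mul, PowerSeries.coeff_expand, PowerSeries.coeff_expand, thetaPhi,
    thetaOmega, PowerSeries.coeff_mk, PowerSeries.coeff_mk, PowerSeries.coeff_mk,
    if_neg (Nat.succ_ne_zero k)]
  by_cases h3 : 3 ∣ k
  · obtain ⟨m, rfl⟩ := h3
    rw [if_neg (c := 9 ∣ 3 * m + 1) (by omega), if_pos (dvd_mul_right _ _), Nat.mul_div_cancel_left _ (by norm_num),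
      pow_succ, pow_mul]
    norm_num
    split_ifs <;> ring
  rw [if_neg h3, mul_zero, sub_zero]
  by_cases h9 : 9 ∣ k + 1
  · obtain ⟨m, hm⟩ := h9
    rw [hm, if_pos (dvd_mul_right _ _), Nat.mul_div_cancel_left _ (by norm_num), pow_mul,
      if_neg (c := m = 0) (by omega), show (-1 : ℤ) ^ 9 = -1 by norm_num]
    congr 1
    refine if_congr ⟨?_, ?_⟩ rfl rfl
    · rintro ⟨r, hr⟩
      obtain ⟨s, rfl⟩ : 3 ∣ r := by
        have h : 3 ∣ r * r := ⟨3 * m, by omega⟩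
        exact (Nat.prime_three.dvd_mul.mp h).elim id id
      exact ⟨s, by nlinarith⟩
    · rintro ⟨s, rfl⟩
      exact ⟨3 * s, by ring⟩
  · rw [if_neg h9, if_neg, mul_zero]
    rintro ⟨r, hr⟩
    have h1 : r * r % 3 = (k + 1) % 3 := by rw [hr]
    have h2 : r % 3 < 3 := Nat.mod_lt _ (by norm_num)
    by_cases h0 : r % 3 = 0
    · obtain ⟨s, rfl⟩ := Nat.dvd_of_mod_eq_zero h0
      exact h9 ⟨s * s, by rw [hr]; ring⟩
    · rw [Nat.mul_mod] at h1
      generalize r % 3 = t at *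
      interval_cases t <;> omega

theorem thetaPhi_neg_one_sq_dissection :
    thetaPhi (-1) ^ 2 = expand 2 two_ne_zero (thetaPhi 1) ^ 2 -
      4 * X * expand 4 four_ne_zero thetaPsi ^ 2 := by
  have h1 := thetaPhi_one_dissection
  have h2 := congrArg PowerSeries.evalNegHom h1
  rw [map_add, map_mul, map_mul, evalNegHom_expand _ (by decide), evalNegHom_expand _ (by decide),
    evalNegHom_thetaPhi, PowerSeries.evalNegHom_X, map_ofNat] at h2
  have h3 := thetaPhi_one_mul_thetaPhi_neg_one
  apply expand_injective two_ne_zero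
  -- After q ↦ q² the first term on the right is φ(q²)-data in q⁴, the left side is φ(q)φ(-q), and
  -- the identity is a difference of squares.
  rw [map_sub, map_mul, map_mul, map_pow, map_pow, map_pow, map_ofNat, PowerSeries.expand_X,
    expand_expand _ _ four_ne_zero (by norm_num),
    expand_expand (c := 8) _ _ (by norm_num) (by norm_num), ← h3]
  nth_rewrite 1 [h1]
  rw [h2]
  ring

theorem thetaPhi_one_sq_dissection :
    thetaPhi 1 ^ 2 = expand 2 two_ne_zero (thetaPhi 1) ^ 2 +
      4 * X * expand 4 four_ne_zero thetaPsi ^ 2 := by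
  have h := congrArg PowerSeries.evalNegHom thetaPhi_neg_one_sq_dissection
  rw [map_sub, map_mul, map_mul, map_pow, map_pow, map_pow, evalNegHom_expand _ (by decide),
    evalNegHom_expand _ (by decide), evalNegHom_thetaPhi, PowerSeries.evalNegHom_X, map_ofNat,
    neg_neg] at h
  rw [h]
  ring

theorem thetaPhi_pow_four_sub :
    thetaPhi 1 ^ 4 - 16 * X * expand 2 two_ne_zero thetaPsi ^ 4 = thetaPhi (-1) ^ 4 := by
  have h1 := thetaPhi_one_sq_dissection
  have h2 := thetaPhi_neg_one_sq_dissection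
  have h3 := congrArg (expand 2 two_ne_zero) thetaPhi_one_mul_expand_thetaPsi
  rw [map_mul, map_pow, expand_expand _ _ four_ne_zero (by norm_num)] at h3
  calc _ = (thetaPhi 1 ^ 2) ^ 2 - 16 * X * (expand 2 two_ne_zero thetaPsi ^ 2) ^ 2 := by ring
    _ = (thetaPhi (-1) ^ 2) ^ 2 := by rw [h1, h2, ← h3]; ring
    _ = _ := by ring

theorem two_mul_mk_v0_four_mul :
    (2 * mk (fun n => v0 (4 * n)) - 1) * thetaPhi (-1) = thetaPhi 1 ^ 2 := by
  have h := two_mul_mk_v0_two_mul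
  have e : expand 2 two_ne_zero (thetaPhi 1) ^ 2 + 4 * X * expand 4 four_ne_zero thetaPsi ^ 2 =
      X ^ (2 * 0 + 0) * expand 2 two_ne_zero (thetaPhi 1 ^ 2) +
      X ^ (2 * 0 + 1) * expand 2 two_ne_zero (4 * expand 2 two_ne_zero thetaPsi ^ 2) := by
    simp only [map_mul, map_pow, map_ofNat, expand_expand _ _ four_ne_zero (by norm_num : 2 * 2 = 4)]
    ring
  have h1 := congrArg (sect 2 0) h
  rw [mul_comm, sect_expand_mul _ (by norm_num), thetaPhi_one_sq_dissection, e, map_add,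
    sect_X_pow_mul_expand _ _ (by norm_num) (by norm_num),
    sect_X_pow_mul_expand _ _ (by norm_num) (by norm_num)] at h1
  have e2 : sect 2 0 (2 * mk (fun n => v0 (2 * n)) - 1) = 2 * mk (fun n => v0 (4 * n)) - 1 := by
    ext n
    rw [coeff_sect, map_sub, map_sub, ← map_ofNat PowerSeries.C 2, PowerSeries.coeff_C_mul,
      PowerSeries.coeff_C_mul, PowerSeries.coeff_one, PowerSeries.coeff_one, PowerSeries.coeff_mk,
      PowerSeries.coeff_mk]
    rw [show 2 * (2 * n + 0) = 4 * n by ring]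
    simp
  rw [e2] at h1
  rw [mul_comm, h1]
  simp

theorem mk_v0_sixteen_mul :
    2 * mk (fun n => v0 (4 * (4 * n + 1))) * thetaPhi (-1) ^ 4 =
      6 * thetaPhi 1 ^ 4 * expand 2 two_ne_zero thetaPsi +
        32 * X * expand 2 two_ne_zero thetaPsi ^ 5 := by
  have h1 := two_mul_mk_v0_four_mul
  have h2 := thetaPhi_one_mul_thetaPhi_neg_one
  have h3 := congrArg (expand 2 two_ne_zero) h2
  have h4 := congrArg (expand 2 two_ne_zero) thetaPhi_one_sq_dissection
  simp only [map_mul, map_pow, map_add, map_ofNat, PowerSeries.expand_X,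
    expand_expand _ _ four_ne_zero (by norm_num : 2 * 2 = 4),
    expand_expand _ _ (by norm_num : 8 ≠ 0) (by norm_num : 2 * 4 = 8)] at h3 h4
  have h5 := thetaPhi_one_dissection
  -- The denominator is rationalised by 1/φ(-q) = φ(q)φ(q²)²/φ(-q⁴)⁴. With a = φ(q⁴) and b = ψ(q⁸),
  -- the numerator is (a + 2qb)³(a² + 4q²b²), sorted by powers of q.
  have h6 : expand 4 four_ne_zero (thetaPhi (-1) ^ 4) * (2 * mk (fun n => v0 (4 * n)) - 1) =
      X ^ (4 * 0 + 0) * expand 4 four_ne_zero (thetaPhi 1 ^ 5) +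
      X ^ (4 * 0 + 1) * expand 4 four_ne_zero
        (6 * thetaPhi 1 ^ 4 * expand 2 two_ne_zero thetaPsi) +
      X ^ (4 * 0 + 2) * expand 4 four_ne_zero
        (16 * thetaPhi 1 ^ 3 * expand 2 two_ne_zero thetaPsi ^ 2) +
      X ^ (4 * 0 + 3) * expand 4 four_ne_zero
        (32 * thetaPhi 1 ^ 2 * expand 2 two_ne_zero thetaPsi ^ 3) +
      X ^ (4 * 1 + 0) * expand 4 four_ne_zero
        (48 * thetaPhi 1 * expand 2 two_ne_zero thetaPsi ^ 4) +
      X ^ (4 * 1 + 1) * expand 4 four_ne_zero (32 * expand 2 two_ne_zero thetaPsi ^ 5) := by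
    simp only [map_mul, map_pow, map_ofNat,
      expand_expand _ _ (by norm_num : 8 ≠ 0) (by norm_num : 4 * 2 = 8)]
    generalize expand 4 _ (thetaPhi 1) = a at *
    generalize expand 8 _ thetaPsi = b at *
    calc _ = (2 * mk (fun n => v0 (4 * n)) - 1) * (expand 4 four_ne_zero (thetaPhi (-1)) ^ 2) ^ 2 :=
          by ring
      _ = ((2 * mk (fun n => v0 (4 * n)) - 1) * thetaPhi (-1)) * thetaPhi 1 *
          expand 2 two_ne_zero (thetaPhi 1) ^ 2 := by rw [← h3, mul_pow, ← h2]; ring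
      _ = _ := by rw [h1, h4, h5]; ring
  have h7 := congrArg (sect 4 1) h6
  simp only [sect_expand_mul _ (by norm_num : 1 < 4), map_add,
    sect_X_pow_mul_expand _ _ (by norm_num : 1 < 4) (by norm_num : 0 < 4),
    sect_X_pow_mul_expand _ _ (by norm_num : 1 < 4) (by norm_num : 1 < 4),
    sect_X_pow_mul_expand _ _ (by norm_num : 1 < 4) (by norm_num : 2 < 4),
    sect_X_pow_mul_expand _ _ (by norm_num : 1 < 4) (by norm_num : 3 < 4)] at h7
  have e2 : sect 4 1 (2 * mk (fun n => v0 (4 * n)) - 1) =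
      2 * mk (fun n => v0 (4 * (4 * n + 1))) := by
    ext n
    rw [coeff_sect, map_sub, ← map_ofNat PowerSeries.C 2, PowerSeries.coeff_C_mul,
      PowerSeries.coeff_C_mul, PowerSeries.coeff_one, PowerSeries.coeff_mk, PowerSeries.coeff_mk]
    simp
  rw [e2] at h7
  rw [mul_comm, h7]
  simp
  ring

theorem mk_v0_thirtytwo_mul :
    mk (fun n => v0 (4 * (8 * n + 1))) * thetaPhi (-1) ^ 8 =
      3 * thetaPsi * thetaPhi (-1) ^ 8 + 512 * X * thetaPsi ^ 9 := by
  have h1 := mk_v0_sixteen_mul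
  have h2 := thetaPhi_one_mul_thetaPhi_neg_one
  have h3 := thetaPhi_one_sq_dissection
  have h4 := thetaPhi_one_mul_expand_thetaPsi
  have h5 := thetaPhi_pow_four_sub
  -- Here 1/φ(-q)⁴ = φ(q)⁴/φ(-q²)⁸, and powers of φ(q)² are split by the 2-dissection.
  have h6 : expand 2 two_ne_zero (thetaPhi (-1) ^ 8) *
        (2 * mk (fun n => v0 (4 * (4 * n + 1)))) =
      X ^ (2 * 0 + 0) * expand 2 two_ne_zero (6 * thetaPsi * thetaPhi 1 ^ 8) +
      X ^ (2 * 0 + 1) * expand 2 two_ne_zero (96 * thetaPsi * thetaPhi 1 ^ 6 *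
        expand 2 two_ne_zero thetaPsi ^ 2 + 32 * thetaPsi ^ 5 * thetaPhi 1 ^ 4) +
      X ^ (2 * 1 + 0) * expand 2 two_ne_zero (576 * thetaPsi * thetaPhi 1 ^ 4 *
        expand 2 two_ne_zero thetaPsi ^ 4 + 256 * thetaPsi ^ 5 * thetaPhi 1 ^ 2 *
        expand 2 two_ne_zero thetaPsi ^ 2) +
      X ^ (2 * 1 + 1) * expand 2 two_ne_zero (1536 * thetaPsi * thetaPhi 1 ^ 2 *
        expand 2 two_ne_zero thetaPsi ^ 6 + 512 * thetaPsi ^ 5 *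
        expand 2 two_ne_zero thetaPsi ^ 4) +
      X ^ (2 * 2 + 0) * expand 2 two_ne_zero
        (1536 * thetaPsi * expand 2 two_ne_zero thetaPsi ^ 8) := by
    simp only [map_mul, map_pow, map_add, map_ofNat,
      expand_expand _ _ four_ne_zero (by norm_num : 2 * 2 = 4)]
    generalize expand 4 _ thetaPsi = b at *
    calc _ = 2 * mk (fun n => v0 (4 * (4 * n + 1))) *
          (expand 2 two_ne_zero (thetaPhi (-1)) ^ 2) ^ 4 := by ring
      _ = (2 * mk (fun n => v0 (4 * (4 * n + 1))) * thetaPhi (-1) ^ 4) * (thetaPhi 1 ^ 2) ^ 2 := by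
          rw [← h2]; ring
      _ = 6 * (thetaPhi 1 ^ 2) ^ 4 * expand 2 two_ne_zero thetaPsi +
        32 * X * expand 2 two_ne_zero thetaPsi ^ 5 * (thetaPhi 1 ^ 2) ^ 2 := by rw [h1]; ring
      _ = _ := by rw [h3]; ring
  have h7 := congrArg (sect 2 0) h6
  simp only [sect_expand_mul _ (by norm_num : 0 < 2), map_add (sect 2 0),
    sect_X_pow_mul_expand _ _ (by norm_num : 0 < 2) (by norm_num : 0 < 2),
    sect_X_pow_mul_expand _ _ (by norm_num : 0 < 2) (by norm_num : 1 < 2)] at h7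
  have e2 : sect 2 0 (2 * mk (fun n => v0 (4 * (4 * n + 1)))) =
      2 * mk (fun n => v0 (4 * (8 * n + 1))) := by
    ext n
    rw [coeff_sect, ← map_ofNat PowerSeries.C 2, PowerSeries.coeff_C_mul,
      PowerSeries.coeff_C_mul, PowerSeries.coeff_mk, PowerSeries.coeff_mk]
    congr 3
    ring
  rw [e2] at h7
  simp only [if_true, one_ne_zero, if_false, pow_zero, one_mul, add_zero, pow_one] at h7
  refine mul_left_cancel₀ (show (2 : ℤ⟦X⟧) ≠ 0 from fun h => by
    have := congrArg PowerSeries.constantCoeff h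
    rw [map_ofNat, map_zero] at this
    norm_num at this) ?_
  calc _ = thetaPhi (-1) ^ 8 * (2 * mk (fun n => v0 (4 * (8 * n + 1)))) := by ring
    _ = 6 * thetaPsi * (thetaPhi 1 ^ 4 - 16 * X * expand 2 two_ne_zero thetaPsi ^ 4) ^ 2 +
      768 * X * thetaPsi * (thetaPhi 1 * expand 2 two_ne_zero thetaPsi) ^ 4 +
      256 * X * thetaPsi ^ 5 * (thetaPhi 1 * expand 2 two_ne_zero thetaPsi) ^ 2 := by
        rw [h7]; ring
    _ = _ := by rw [h4, h5]; ring

end dissection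

/-! ### Congruences modulo 27. -/

section congruence

open PowerSeries (X coeff expand mk C)

theorem C_dvd_iff (c : ℤ) (f : ℤ⟦X⟧) : C c ∣ f ↔ ∀ n, c ∣ coeff n f := by
  refine ⟨?_, fun h => ?_⟩
  · rintro ⟨g, rfl⟩ n
    rw [PowerSeries.coeff_C_mul]
    exact dvd_mul_right _ _
  · choose g hg using h
    refine ⟨mk g, ?_⟩
    ext n
    rw [PowerSeries.coeff_C_mul, PowerSeries.coeff_mk, hg]

theorem C_dvd_sect {c : ℤ} {f : ℤ⟦X⟧} (h : C c ∣ f) (d r : ℕ) : C c ∣ sect d r f := by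
  rw [C_dvd_iff] at h ⊢
  intro n
  rw [coeff_sect]
  exact h _

theorem three_dvd_pow_three_sub_expand (f : ℤ⟦X⟧) : C 3 ∣ f ^ 3 - expand 3 three_ne_zero f := by
  have : Fact (Nat.Prime 3) := ⟨Nat.prime_three⟩
  rw [C_dvd_iff]
  intro n
  have h : PowerSeries.map (Int.castRingHom (ZMod 3)) (f ^ 3 - expand 3 three_ne_zero f) = 0 := by
    rw [map_sub, map_pow, PowerSeries.map_expand, sub_eq_zero]
    have := MvPowerSeries.map_frobenius_expand (R := ZMod 3) 3 three_ne_zero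
      (f := (PowerSeries.map (Int.castRingHom (ZMod 3)) f : MvPowerSeries Unit (ZMod 3)))
    rw [ZMod.frobenius_zmod] at this
    refine this.symm.trans ?_
    rw [MvPowerSeries.map_id]
    rfl
  have h2 := congrArg (coeff n) h
  rw [PowerSeries.coeff_map, map_zero, eq_intCast] at h2
  exact (ZMod.intCast_zmod_eq_zero_iff_dvd _ 3).mp h2

theorem isUnit_thetaPhi (ε : ℤ) : IsUnit (thetaPhi ε) := by
  rw [PowerSeries.isUnit_iff_constantCoeff, ← PowerSeries.coeff_zero_eq_constantCoeff_apply,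
    thetaPhi, PowerSeries.coeff_mk]
  simp

theorem isUnit_expand {f : ℤ⟦X⟧} (h : IsUnit f) (d : ℕ) (hd : d ≠ 0) : IsUnit (expand d hd f) :=
  h.map _

/-- The congruence ψ(q)/φ(-q) ≡ A(q³)/φ(-q⁹) mod 3, cleared of denominators and with its error term
explicit. -/
theorem thetaPsi_mul_expand_sub :
    thetaPsi * expand 9 (by norm_num) (thetaPhi (-1)) =
      expand 3 three_ne_zero thetaA * thetaPhi (-1) +
        3 * (X * expand 9 (by norm_num) thetaPsi * expand 9 (by norm_num) (thetaPhi (-1))) := by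
  have h1 := thetaPsi_dissection
  have h2 := thetaPhi_neg_one_dissection
  have h3 := congrArg (expand 3 three_ne_zero) thetaA_mul_thetaOmega
  rw [map_mul, map_mul, expand_expand (c := 9) _ _ (by norm_num) (by norm_num),
    expand_expand (c := 9) _ _ (by norm_num) (by norm_num)] at h3
  linear_combination expand 9 (by norm_num) (thetaPhi (-1)) * h1 -
    expand 3 three_ne_zero thetaA * h2 + 2 * X * h3

theorem C_twentySeven_dvd_add_pow_nine_sub (y z : ℤ⟦X⟧) : C 27 ∣ (y + 3 * z) ^ 9 - y ^ 9 := by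
  refine ⟨y ^ 8 * z + 12 * y ^ 7 * z ^ 2 + 84 * y ^ 6 * z ^ 3 + 378 * y ^ 5 * z ^ 4 +
    1134 * y ^ 4 * z ^ 5 + 2268 * y ^ 3 * z ^ 6 + 2916 * y ^ 2 * z ^ 7 + 2187 * y * z ^ 8 +
    729 * z ^ 9, ?_⟩
  rw [map_ofNat]
  ring

/-- The generating function of `v0 (32 n + 4)` without its theta part. -/
noncomputable def v0Rest : ℤ⟦X⟧ := mk (fun n => v0 (4 * (8 * n + 1))) - 3 * thetaPsi

theorem v0Rest_mul : v0Rest * thetaPhi (-1) ^ 8 = 512 * X * thetaPsi ^ 9 := by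
  rw [v0Rest]
  linear_combination mk_v0_thirtytwo_mul

theorem C_twentySeven_dvd_v0Rest_mul_sub :
    C 27 ∣ v0Rest * expand 9 (by norm_num) (thetaPhi (-1)) ^ 9 -
      512 * X * expand 3 three_ne_zero thetaA ^ 9 * thetaPhi (-1) := by
  have h := C_twentySeven_dvd_add_pow_nine_sub (expand 3 three_ne_zero thetaA * thetaPhi (-1))
    (X * expand 9 (by norm_num) thetaPsi * expand 9 (by norm_num) (thetaPhi (-1)))
  rw [← thetaPsi_mul_expand_sub] at h
  rw [← ((isUnit_thetaPhi (-1)).pow 8).dvd_mul_right]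
  convert h.mul_left (512 * X) using 1
  linear_combination expand 9 (by norm_num) (thetaPhi (-1)) ^ 9 * v0Rest_mul

/-- Modulo 27 the only factor that is not a series in q³ is qφ(-q), whose exponents are 1 or 2 mod
3. -/
theorem v0Rest_sections :
    C 27 ∣ sect 3 0 v0Rest ∧
      C 27 ∣ expand 3 three_ne_zero (thetaPhi (-1)) ^ 8 * sect 3 1 v0Rest - 512 * thetaA ^ 9 := by
  have h := C_twentySeven_dvd_v0Rest_mul_sub
  have e : v0Rest * expand 9 (by norm_num) (thetaPhi (-1)) ^ 9 -
      512 * X * expand 3 three_ne_zero thetaA ^ 9 * thetaPhi (-1) =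
      expand 3 three_ne_zero (expand 3 three_ne_zero (thetaPhi (-1)) ^ 9) * v0Rest -
      X ^ (3 * 0 + 1) * expand 3 three_ne_zero
        (512 * thetaA ^ 9 * expand 3 three_ne_zero (thetaPhi (-1))) +
      X ^ (3 * 0 + 2) * expand 3 three_ne_zero (1024 * thetaA ^ 9 * thetaOmega) := by
    simp only [map_mul, map_pow, map_ofNat,
      expand_expand _ _ (by norm_num : 9 ≠ 0) (by norm_num : 3 * 3 = 9)]
    linear_combination (-512 * X * expand 3 three_ne_zero thetaA ^ 9) * thetaPhi_neg_one_dissection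
  have hu := isUnit_expand (isUnit_thetaPhi (-1)) 3 three_ne_zero
  rw [e] at h
  constructor
  · have h0 := C_dvd_sect h 3 0
    rw [map_add, map_sub, sect_expand_mul _ (by norm_num),
      sect_X_pow_mul_expand _ _ (by norm_num) (by norm_num),
      sect_X_pow_mul_expand _ _ (by norm_num) (by norm_num)] at h0
    simp only [one_ne_zero, two_ne_zero, if_false, sub_zero, add_zero] at h0
    exact (hu.pow 9).dvd_mul_left.mp h0
  · have h1 := C_dvd_sect h 3 1
    rw [map_add, map_sub, sect_expand_mul _ (by norm_num),
      sect_X_pow_mul_expand _ _ (by norm_num) (by norm_num),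
      sect_X_pow_mul_expand _ _ (by norm_num) (by norm_num), if_pos rfl,
      if_neg (by norm_num)] at h1
    rw [← hu.dvd_mul_left]
    convert h1 using 1
    ring

/-- The denominator of the dissection of `1 / φ(-q)` modulo `3`. -/
noncomputable def cubicDenom : ℤ⟦X⟧ :=
  expand 3 three_ne_zero (thetaPhi (-1)) ^ 3 - 8 * X * thetaOmega ^ 3

theorem isUnit_cubicDenom : IsUnit cubicDenom := by
  have h := (isUnit_expand (isUnit_thetaPhi (-1)) 3 three_ne_zero).pow 3
  rw [PowerSeries.isUnit_iff_constantCoeff] at h ⊢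
  simpa [cubicDenom] using h

/-- The factorisation x³ - y³ with x = φ(-q⁹), y = 2qΩ(q³) and x - y = φ(-q). -/
theorem expand_cubicDenom :
    expand 3 three_ne_zero cubicDenom = thetaPhi (-1) *
      (expand 9 (by norm_num) (thetaPhi (-1)) ^ 2 +
        2 * X * expand 9 (by norm_num) (thetaPhi (-1)) * expand 3 three_ne_zero thetaOmega +
        4 * X ^ 2 * expand 3 three_ne_zero thetaOmega ^ 2) := by
  rw [cubicDenom]
  simp only [map_mul, map_pow, map_sub, map_ofNat, PowerSeries.expand_X,
    expand_expand _ _ (by norm_num : 9 ≠ 0) (by norm_num : 3 * 3 = 9)]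
  nth_rewrite 2 [thetaPhi_neg_one_dissection]
  ring

/-- Modulo 3, x² + xy + y² ≡ (x - y)², so the expanded denominator is ≡ φ(-q)³ ≡ φ(-q³). -/
theorem C_three_dvd_cubicDenom_sub : C 3 ∣ cubicDenom - thetaPhi (-1) := by
  have h : C 3 ∣ expand 3 three_ne_zero (cubicDenom - thetaPhi (-1)) := by
    have h1 := three_dvd_pow_three_sub_expand (thetaPhi (-1))
    have h2 : C 3 ∣ expand 3 three_ne_zero cubicDenom - thetaPhi (-1) ^ 3 := by
      refine ⟨thetaPhi (-1) * (2 * X * expand 9 (by norm_num) (thetaPhi (-1)) *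
        expand 3 three_ne_zero thetaOmega), ?_⟩
      rw [expand_cubicDenom, map_ofNat]
      linear_combination (-thetaPhi (-1) * (thetaPhi (-1) +
        expand 9 (by norm_num) (thetaPhi (-1)) - 2 * X * expand 3 three_ne_zero thetaOmega)) *
        thetaPhi_neg_one_dissection
    rw [map_sub]
    convert dvd_add h1 h2 using 1
    ring
  rw [C_dvd_iff] at h ⊢
  intro n
  simpa only [PowerSeries.coeff_expand_mul] using h (3 * n)

theorem C_twentySeven_dvd_sect_mul_sub :
    C 27 ∣ sect 3 1 v0Rest * thetaPhi (-1) * expand 9 (by norm_num) (thetaPhi (-1)) ^ 3 -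
      512 * expand 3 three_ne_zero (thetaPhi (-1)) * (expand 3 three_ne_zero thetaA ^ 3 *
        thetaPhi (-1) + 9 * X * expand 3 three_ne_zero thetaA ^ 2 *
        expand 9 (by norm_num) thetaPsi * expand 9 (by norm_num) (thetaPhi (-1))) := by
  have h := v0Rest_sections.2
  have hu := isUnit_expand (isUnit_thetaPhi (-1)) 3 three_ne_zero
  have hA := thetaA_pow_three_mul
  have hψ := thetaPsi_mul_expand_sub
  generalize expand 3 _ (thetaPhi (-1)) = R at *
  generalize expand 9 _ (thetaPhi (-1)) = P at *
  generalize expand 9 _ thetaPsi = B at *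
  generalize expand 3 _ thetaA = a at *
  -- The cube of `thetaA_pow_three_mul` trades A⁹ for ψ³. Cubing aφ(-q) + 3z below then leaves only
  -- two terms mod 27.
  have h1 : C 27 ∣ sect 3 1 v0Rest * thetaPhi (-1) ^ 3 - 512 * R * thetaPsi ^ 3 := by
    rw [← (hu.pow 8).dvd_mul_left]
    convert h.mul_left (thetaPhi (-1) ^ 3) using 1
    have : (thetaA ^ 3 * thetaPhi (-1)) ^ 3 = (R ^ 3 * thetaPsi) ^ 3 := by rw [hA]
    linear_combination 512 * this
  rw [← ((isUnit_thetaPhi (-1)).pow 2).dvd_mul_left]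
  convert dvd_add (h1.mul_left (P ^ 3)) (Dvd.intro (512 * R * (a * thetaPhi (-1) * (X * B * P) ^ 2 +
    (X * B * P) ^ 3)) rfl : C 27 ∣ C 27 * (512 * R * (a * thetaPhi (-1) * (X * B * P) ^ 2 +
    (X * B * P) ^ 3))) using 1
  have : (thetaPsi * P) ^ 3 = (a * thetaPhi (-1) + 3 * (X * B * P)) ^ 3 := by rw [hψ]
  rw [map_ofNat]
  linear_combination 512 * R * this

/-- Multiplying by (x³ - y³)/(x - y) makes the coefficient of `sect 3 1 v0Rest` a series in q³. Of
the terms carrying the factor 9, only q · 4q²Ω² lands in the class 0 mod 3; 18432 = 4 · 9 · 512. -/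
theorem C_twentySeven_dvd_cubicDenom_mul :
    C 27 ∣ cubicDenom * (sect 3 0 (sect 3 1 v0Rest) - 512 * thetaPsi) -
      18432 * X * thetaPhi (-1) * expand 3 three_ne_zero thetaPsi ^ 3 := by
  have h := C_twentySeven_dvd_sect_mul_sub.mul_left
    (expand 9 (by norm_num) (thetaPhi (-1)) ^ 2 +
        2 * X * expand 9 (by norm_num) (thetaPhi (-1)) * expand 3 three_ne_zero thetaOmega +
        4 * X ^ 2 * expand 3 three_ne_zero thetaOmega ^ 2)
  have hK := expand_cubicDenom
  set R := expand 3 three_ne_zero (thetaPhi (-1)) with hR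
  set ψ₃ := expand 3 three_ne_zero thetaPsi with hψ₃
  have e : (expand 9 (by norm_num) (thetaPhi (-1)) ^ 2 +
        2 * X * expand 9 (by norm_num) (thetaPhi (-1)) * expand 3 three_ne_zero thetaOmega +
        4 * X ^ 2 * expand 3 three_ne_zero thetaOmega ^ 2) *
      (sect 3 1 v0Rest * thetaPhi (-1) * expand 9 (by norm_num) (thetaPhi (-1)) ^ 3 -
      512 * R * (expand 3 three_ne_zero thetaA ^ 3 *
        thetaPhi (-1) + 9 * X * expand 3 three_ne_zero thetaA ^ 2 *
        expand 9 (by norm_num) thetaPsi * expand 9 (by norm_num) (thetaPhi (-1)))) =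
      expand 3 three_ne_zero (cubicDenom * R ^ 3) * sect 3 1 v0Rest -
      X ^ (3 * 0 + 0) * expand 3 three_ne_zero (512 * thetaPhi (-1) * thetaA ^ 3 * cubicDenom) -
      X ^ (3 * 0 + 1) * expand 3 three_ne_zero
        (4608 * thetaPhi (-1) * thetaA ^ 2 * ψ₃ * R ^ 3) -
      X ^ (3 * 0 + 2) * expand 3 three_ne_zero
        (9216 * thetaPhi (-1) * thetaA ^ 2 * ψ₃ * R ^ 2 * thetaOmega) -
      X ^ (3 * 1 + 0) * expand 3 three_ne_zero
        (18432 * thetaPhi (-1) * thetaA ^ 2 * ψ₃ * R * thetaOmega ^ 2) := by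
    simp only [map_mul, map_pow, map_ofNat, hK]
    rw [hψ₃, hR]
    simp only [expand_expand _ _ (by norm_num : 9 ≠ 0) (by norm_num : 3 * 3 = 9)]
    ring
  rw [e] at h
  have h0 := C_dvd_sect h 3 0
  simp only [map_sub (sect 3 0), sect_expand_mul _ (by norm_num : 0 < 3),
    sect_X_pow_mul_expand _ _ (by norm_num : 0 < 3) (by norm_num : 0 < 3),
    sect_X_pow_mul_expand _ _ (by norm_num : 0 < 3) (by norm_num : 1 < 3),
    sect_X_pow_mul_expand _ _ (by norm_num : 0 < 3) (by norm_num : 2 < 3), if_true,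
    one_ne_zero, two_ne_zero, if_false, sub_zero, pow_zero, one_mul, pow_one] at h0
  have hu : IsUnit R := isUnit_expand (isUnit_thetaPhi (-1)) 3 three_ne_zero
  rw [← (hu.pow 3).dvd_mul_left]
  convert h0 using 1
  have h1 := thetaA_pow_three_mul
  have h2 := thetaA_mul_thetaOmega
  rw [← hR] at h1 h2
  rw [← hψ₃] at h2
  have h3 : thetaA ^ 2 * thetaOmega ^ 2 = ψ₃ ^ 2 * R ^ 2 := by rw [← mul_pow, h2, mul_pow]
  linear_combination 512 * cubicDenom * h1 + 18432 * X * thetaPhi (-1) * ψ₃ * R * h3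

theorem C_twentySeven_dvd_sect_sub :
    C 27 ∣ sect 3 0 (sect 3 1 v0Rest) - 512 * thetaPsi -
      18432 * X * expand 9 (by norm_num) thetaPsi := by
  have h := C_twentySeven_dvd_cubicDenom_mul
  set J := sect 3 0 (sect 3 1 v0Rest) - 512 * thetaPsi
  obtain ⟨c, hc⟩ := C_three_dvd_cubicDenom_sub
  obtain ⟨w, hw⟩ := h
  rw [map_ofNat] at hc hw
  -- Since 9 ∣ 18432, also 9 ∣ J; hence modulo 27 the denominator and the cube of ψ(q³) matter only
  -- modulo 3.
  have h9 : C 9 ∣ J := by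
    rw [← isUnit_cubicDenom.dvd_mul_left]
    refine ⟨3 * w + 2048 * X * thetaPhi (-1) * expand 3 three_ne_zero thetaPsi ^ 3, ?_⟩
    rw [map_ofNat]
    linear_combination hw
  obtain ⟨j, hj⟩ := h9
  obtain ⟨g, hg⟩ := three_dvd_pow_three_sub_expand (expand 3 three_ne_zero thetaPsi)
  rw [expand_expand (c := 9) _ _ (by norm_num) (by norm_num)] at hg
  rw [map_ofNat] at hj hg
  have h1 : C 27 ∣ J - 18432 * X * expand 3 three_ne_zero thetaPsi ^ 3 := by
    rw [← (isUnit_thetaPhi (-1)).dvd_mul_left]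
    refine ⟨w - c * j, ?_⟩
    rw [map_ofNat]
    linear_combination hw - J * hc - 3 * c * hj
  convert dvd_add h1 (Dvd.intro (2048 * X * g) rfl : C 27 ∣ C 27 * (2048 * X * g)) using 1
  rw [map_ofNat]
  linear_combination 18432 * X * hg

theorem coeff_mk_sub_thetaPsi (n : ℕ) (h : ¬ IsSquare (8 * n + 1)) :
    coeff n v0Rest = v0 (4 * (8 * n + 1)) := by
  rw [v0Rest, map_sub, ← map_ofNat C 3, PowerSeries.coeff_C_mul, thetaPsi, PowerSeries.coeff_mk,
    PowerSeries.coeff_mk, if_neg h]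
  ring

theorem dvd_v0_of_mod_three (n : ℕ) (h : ¬ IsSquare (8 * (3 * n) + 1)) :
    27 ∣ v0 (4 * (8 * (3 * n) + 1)) := by
  have := (C_dvd_iff _ _).mp v0Rest_sections.1 n
  rwa [coeff_sect, add_zero, coeff_mk_sub_thetaPsi _ h] at this

theorem dvd_v0_nine_mul (n : ℕ) (h : ¬ IsSquare (8 * n + 1)) :
    27 ∣ v0 (4 * (9 * (8 * n + 1))) := by
  have h1 := (C_dvd_iff _ _).mp C_twentySeven_dvd_sect_sub n
  have h9 : ¬ IsSquare (8 * (3 * (3 * n + 0) + 1) + 1) := by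
    rintro ⟨r, hr⟩
    obtain ⟨s, rfl⟩ : 3 ∣ r := by
      have h : 3 ∣ r * r := ⟨24 * n + 3, by omega⟩
      exact (Nat.prime_three.dvd_mul.mp h).elim id id
    exact h ⟨s, by nlinarith⟩
  -- A nonzero coefficient would mean n = 9m + 1 with 8m + 1 = s², so that 8n + 1 = (3s)².
  have hX : coeff n (X * expand 9 (by norm_num) thetaPsi) = 0 := by
    rcases n with _ | k
    · simp
    rw [PowerSeries.coeff_succ_X_mul, PowerSeries.coeff_expand, thetaPsi, PowerSeries.coeff_mk]
    split_ifs with h2 h3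
    · obtain ⟨m, rfl⟩ := h2
      rw [Nat.mul_div_cancel_left _ (by norm_num)] at h3
      obtain ⟨s, hs⟩ := h3
      exact absurd ⟨3 * s, by nlinarith⟩ h
    · rfl
    · rfl
  rw [map_sub, map_sub, coeff_sect, coeff_sect, coeff_mk_sub_thetaPsi _ h9, mul_assoc,
    ← map_ofNat C 512, ← map_ofNat C 18432, PowerSeries.coeff_C_mul, PowerSeries.coeff_C_mul, hX,
    thetaPsi, PowerSeries.coeff_mk, if_neg h, mul_zero, mul_zero, sub_zero, sub_zero] at h1
  convert h1 using 3
  ring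

end congruence

/-! ### Prime powers, squares and pentagonal numbers. -/

section arithmetic

theorem isSquare_of_isSquare_sq_mul {x m : ℕ} (hx : x ≠ 0) (h : IsSquare (x ^ 2 * m)) :
    IsSquare m := by
  obtain ⟨r, hr⟩ := h
  rw [← sq] at hr
  obtain ⟨s, rfl⟩ : x ∣ r := (Nat.pow_dvd_pow_iff two_ne_zero).mp ⟨m, hr.symm⟩
  refine ⟨s, ?_⟩
  rw [mul_pow] at hr
  rw [Nat.eq_of_mul_eq_mul_left (by positivity) hr, sq]

theorem Nat.Prime.sq_mod_twentyFour {p : ℕ} (hp : p.Prime) (h5 : 5 ≤ p) : p ^ 2 % 24 = 1 := by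
  have h2 : p % 2 ≠ 0 := fun h => by
    have := (Nat.prime_dvd_prime_iff_eq Nat.prime_two hp).mp (Nat.dvd_of_mod_eq_zero h)
    omega
  have h3 : p % 3 ≠ 0 := fun h => by
    have := (Nat.prime_dvd_prime_iff_eq Nat.prime_three hp).mp (Nat.dvd_of_mod_eq_zero h)
    omega
  have h4 : p % 24 < 24 := Nat.mod_lt _ (by norm_num)
  have h6 : p % 24 % 2 ≠ 0 := by omega
  have h7 : p % 24 % 3 ≠ 0 := by omega
  rw [Nat.pow_mod]
  generalize p % 24 = t at *
  interval_cases t <;> simp_all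

theorem dvd_v0_prime_pow_mul {p : ℕ} (hp : p.Prime) (hp3 : 3 ≤ p) (α : ℕ) {m : ℕ}
    (hm : m % 24 = 1) (hsq : ¬ IsSquare m) : 27 ∣ v0 (p ^ (2 * α) * (4 * m)) := by
  have hns : ∀ β, ¬ IsSquare (p ^ (2 * β) * m) := by
    intro β h
    rw [mul_comm 2 β, pow_mul] at h
    exact hsq (isSquare_of_isSquare_sq_mul (pow_ne_zero _ hp.ne_zero) h)
  rw [mul_left_comm]
  have main : (p ^ (2 * α) * m) % 24 = 1 → 27 ∣ v0 (4 * (p ^ (2 * α) * m)) := by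
    intro h
    obtain ⟨k, hk⟩ : ∃ k, p ^ (2 * α) * m = 8 * (3 * k) + 1 :=
      ⟨p ^ (2 * α) * m / 24, by omega⟩
    have := hns α
    rw [hk] at this ⊢
    exact dvd_v0_of_mod_three k this
  by_cases h3 : p = 3
  -- For p = 3 one factor 9 is split off; the cofactor 3^{2β}m is still 1 mod 8 and not a square.
  · subst h3
    rcases α with _ | β
    · exact main (by simpa using hm)
    have h8 : 3 ^ (2 * β) * m % 8 = 1 := by
      rw [Nat.mul_mod, pow_mul, Nat.pow_mod, show m % 8 = 1 by omega]
      simp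
    obtain ⟨k, hk⟩ : ∃ k, 3 ^ (2 * β) * m = 8 * k + 1 := ⟨3 ^ (2 * β) * m / 8, by omega⟩
    have := hns β
    rw [show 3 ^ (2 * (β + 1)) * m = 9 * (3 ^ (2 * β) * m) by ring]
    rw [hk] at this ⊢
    exact dvd_v0_nine_mul k this
  · have h5 : 5 ≤ p := by
      have h4 : p ≠ 4 := fun h => absurd hp (by rw [h]; decide)
      omega
    refine main ?_
    rw [Nat.mul_mod, pow_mul, Nat.pow_mod, hp.sq_mod_twentyFour h5, hm]
    simp

theorem exists_pentagonal_of_isSquare {n : ℕ} (h : IsSquare (24 * n + 1)) :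
    ∃ k : ℤ, (n : ℤ) = k * (3 * k + 1) / 2 := by
  obtain ⟨r, hr⟩ := h
  have h6 : r % 6 = 1 ∨ r % 6 = 5 := by
    have h1 : r * r % 6 = 1 := by omega
    have h2 : r % 6 < 6 := Nat.mod_lt _ (by norm_num)
    rw [Nat.mul_mod] at h1
    generalize r % 6 = t at *
    interval_cases t <;> simp_all
  obtain ⟨k, hk⟩ : ∃ k : ℤ, (r : ℤ) = 6 * k + 1 ∨ (r : ℤ) = -(6 * k + 1) := by
    rcases h6 with h | h
    · exact ⟨r / 6, by omega⟩
    · exact ⟨-((r + 1) / 6), by omega⟩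
  have hr' : (24 * n + 1 : ℤ) = (6 * k + 1) * (6 * k + 1) := by
    have : (24 * n + 1 : ℤ) = r * r := by exact_mod_cast hr
    rw [this]
    rcases hk with h | h <;> rw [h]
    ring
  exact ⟨k, by rw [show k * (3 * k + 1) = n * 2 by linarith]; simp⟩

end arithmetic

theorem mainTheorem11 (p p₁ : ℕ) (hp : p.Prime) (hp3 : 3 ≤ p) (hp₁ : p₁.Prime) (hp₁5 : 5 ≤ p₁)
    (α : ℕ) :
    (∀ n : ℕ, (∀ k : ℤ, (n : ℤ) ≠ k * (3 * k + 1) / 2) →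
      v0 (p ^ (2 * α) * (96 * n + 4)) ≡ 0 [ZMOD 27]) ∧
    (∀ n i : ℕ, 1 ≤ i → i ≤ p₁ - 1 →
      v0 (p ^ (2 * α) * p₁ * (96 * p₁ * n + 96 * i + 4 * p₁)) ≡ 0 [ZMOD 27]) ∧
    (∀ n j : ℕ, ¬ IsSquare ((24 * j + 1 : ℕ) : ZMod p₁) →
      v0 (p ^ (2 * α) * (96 * p₁ * n + 96 * j + 4)) ≡ 0 [ZMOD 27]) := by
  refine ⟨fun n hn => ?_, fun n i hi hi' => ?_, fun n j hj => ?_⟩ <;> rw [Int.modEq_zero_iff_dvd]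
  · rw [show 96 * n + 4 = 4 * (24 * n + 1) by ring]
    refine dvd_v0_prime_pow_mul hp hp3 α (by omega) fun h => ?_
    obtain ⟨k, hk⟩ := exists_pentagonal_of_isSquare h
    exact hn k hk
  · rw [show p ^ (2 * α) * p₁ * (96 * p₁ * n + 96 * i + 4 * p₁) =
      p ^ (2 * α) * (4 * (24 * (p₁ * (p₁ * n + i)) + p₁ ^ 2)) by ring]
    have h1 := hp₁.sq_mod_twentyFour hp₁5
    refine dvd_v0_prime_pow_mul hp hp3 α (by omega) ?_
    rintro ⟨r, hr⟩
    -- A square divisible by p₁ is divisible by p₁², which would force p₁ ∣ 24i; this fails for p₁ ≥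
    -- 5 and 0 < i < p₁.
    obtain ⟨s, rfl⟩ : p₁ ∣ r := by
      have h : p₁ ∣ r * r := ⟨24 * (p₁ * n + i) + p₁, by rw [← hr]; ring⟩
      exact (hp₁.dvd_mul.mp h).elim id id
    have h2 : 24 * (p₁ * n + i) + p₁ = p₁ * (s * s) :=
      Nat.eq_of_mul_eq_mul_left hp₁.pos (by linarith)
    have h3 : p₁ ∣ 24 * i := by
      have h4 : p₁ ∣ 24 * i + p₁ * (24 * n + 1) := ⟨s * s, by linarith⟩
      exact (Nat.dvd_add_left (dvd_mul_right _ _)).mp h4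
    rcases hp₁.dvd_mul.mp h3 with h | h
    · rcases hp₁.dvd_mul.mp (show p₁ ∣ 2 ^ 3 * 3 by simpa using h) with h | h
      · have := Nat.le_of_dvd (by norm_num) (hp₁.dvd_of_dvd_pow h)
        omega
      · have := Nat.le_of_dvd (by norm_num) h
        omega
    · have := Nat.le_of_dvd hi h
      omega
  · rw [show 96 * p₁ * n + 96 * j + 4 = 4 * (24 * (p₁ * n + j) + 1) by ring]
    refine dvd_v0_prime_pow_mul hp hp3 α (by omega) ?_
    rintro ⟨r, hr⟩
    refine hj ⟨r, ?_⟩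
    have := congrArg (Nat.cast (R := ZMod p₁)) hr
    push_cast at this ⊢
    simpa using this
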